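/- Let $p$ be a prime and let $n\ge 0$ be an integer with $p>n+1$. Let $W=W(\bar{\mathbb F}_p)\subset\mathbb C_p$ be the ring of Witt vectors of $\bar{\mathbb F}_p$, i.e. the ring of integers of the completion of the maximal unramified extension of $\mathbb Q_p$, and let $X=\{z\in W : |z|=|z-1|=1\}$. Let $\operatorname{Li}_m$ ($m\ge 0$) be Coleman's $p$-adic polylogarithms, with $\operatorname{Li}_0(z)=z/(1-z)$, and set $\widetilde{\operatorname{Li}}_m(z)=p^{-m}\operatorname{Li}_m(z)$. Let $\alpha\in X$ be a root of unity and let $w\in W$. Then $p^{-n}\operatorname{Li}_n(\alpha(1+pw))$ and $\sum_{k=0}^{n}\widetilde{\operatorname{Li}}_{n-k}(\alpha)\,\frac{w^k}{k!}$ both lie in $W$, and $$p^{-n}\operatorname{Li}_n(\alpha(1+pw))\;\equiv\;\sum_{k=0}^{n}\widetilde{\operatorname{Li}}_{n-k}(\alpha)\,\frac{w^k}{k!}\pmod{pW}.$$ -/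

import Mathlib

set_option linter.unusedSectionVars false
set_option linter.unusedVariables false

open Filter Topology

noncomputable section
namespace ColemanPolylog

section Definitions

variable (K : Type*) [NormedField K]

/-- The closed unit disc with the open residue disc of `1` removed, that is, the set of all `z`
with `‖z‖ ≤ 1` and `‖z - 1‖ = 1`. It is an affinoid, a union of open residue discs, and it is
stable under the Frobenius lift `z ↦ z ^ p`. -/
def affinoid : Set K := {z | ‖z‖ ≤ 1 ∧ 1 ≤ ‖z - 1‖}

variable {K}

/-- Rigid analytic functions on the affinoid: uniform limits of rational functions without poles
on it. -/
def IsRigidAnalytic (f : K → K) : Prop :=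
  ∀ ε : ℝ, 0 < ε → ∃ P Q : Polynomial K,
    ∀ z ∈ affinoid K, Q.eval z ≠ 0 ∧ ‖f z - P.eval z / Q.eval z‖ ≤ ε

end Definitions

/-- Coleman's characterization of the `p`-adic polylogarithms on the affinoid: `Li 0` is
`z / (1 - z)`; each `Li n` is given by one convergent power series on each open residue disc;
`d Li (n + 1) = Li n * dz / z`; `Li n` vanishes at `0`; and `Li n z - Li n (z ^ p) / p ^ n` is
rigid analytic (the Frobenius condition). On the affinoid these conditions determine the family
uniquely: a difference of two candidates for `Li n` is locally constant, its Frobenius transform is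
rigid analytic with derivative zero, hence constant, hence zero because of the value at `0`, and
every residue disc is periodic under the Frobenius. -/
structure IsColemanPolylog (p : ℕ) {K : Type*} [NontriviallyNormedField K]
    (Li : ℕ → K → K) : Prop where
  zero : ∀ z ∈ affinoid K, Li 0 z = z / (1 - z)
  locallyAnalytic : ∀ n, ∀ a ∈ affinoid K,
    ∃ c : FormalMultilinearSeries K K K, HasFPowerSeriesOnBall (Li n) c a 1
  deriv : ∀ n, ∀ z ∈ affinoid K, z ≠ 0 → HasDerivAt (Li (n + 1)) (Li n z / z) z
  apply_zero : ∀ n, Li n 0 = 0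
  frobenius : ∀ n, IsRigidAnalytic fun z => Li n z - Li n (z ^ p) / (p : K) ^ n

/-! The helper facts up to the next headline serve only to show that such a family exists over
the field `ℂ_[p]`. -/

section PowerSeriesOnDiscs

variable {K : Type*} [NontriviallyNormedField K]

/-- The coefficient sequence `c` converges on the open unit disc. -/
def ConvOnDisc (c : ℕ → K) : Prop :=
  ∀ r : ℝ, 0 ≤ r → r < 1 → Summable fun k => ‖c k‖ * r ^ k

/-- `f (a + u) = ∑ c k * u ^ k` on the open unit disc `‖u‖ < 1`. -/
def DiscSeries (f : K → K) (a : K) (c : ℕ → K) : Prop :=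
  ConvOnDisc c ∧ ∀ u : K, ‖u‖ < 1 → HasSum (fun k => c k * u ^ k) (f (a + u))

theorem ConvOnDisc.mul_nat {c : ℕ → K} (hc : ConvOnDisc c) {r : ℝ} (h0 : 0 ≤ r) (h1 : r < 1) :
    Summable fun k : ℕ => (k : ℝ) * (‖c k‖ * r ^ k) := by
  obtain ⟨s, hrs, hs1⟩ := exists_between h1
  have hs0 : 0 < s := lt_of_le_of_lt h0 hrs
  have hq : r / s < 1 := (div_lt_one hs0).2 hrs
  have hq0 : 0 ≤ r / s := by positivity
  obtain ⟨B, hB⟩ := (tendsto_self_mul_const_pow_of_lt_one hq0 hq).bddAbove_range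
  have hB' : ∀ k : ℕ, (k : ℝ) * (r / s) ^ k ≤ B := fun k => hB ⟨k, rfl⟩
  refine Summable.of_nonneg_of_le (fun k => by positivity) (fun k => ?_)
    ((hc s hs0.le hs1).mul_left B)
  have : (k : ℝ) * (‖c k‖ * r ^ k) = ((k : ℝ) * (r / s) ^ k) * (‖c k‖ * s ^ k) := by
    rw [div_pow]; field_simp
  rw [this]
  exact mul_le_mul_of_nonneg_right (hB' k) (by positivity)

theorem ConvOnDisc.of_bounded {c : ℕ → K} {B : ℝ} (hc : ∀ k, ‖c k‖ ≤ B) : ConvOnDisc c := by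
  intro r h0 h1
  refine Summable.of_nonneg_of_le (fun k => by positivity) (fun k => ?_)
    ((summable_geometric_of_lt_one h0 h1).mul_left B)
  exact mul_le_mul_of_nonneg_right (hc k) (by positivity)

theorem DiscSeries.add {f g : K → K} {a : K} {c d : ℕ → K} (hf : DiscSeries f a c)
    (hg : DiscSeries g a d) : DiscSeries (fun z => f z + g z) a (fun k => c k + d k) := by
  refine ⟨fun r h0 h1 => ?_, fun u hu => ?_⟩
  · refine Summable.of_nonneg_of_le (fun k => by positivity) (fun k => ?_)
      ((hf.1 r h0 h1).add (hg.1 r h0 h1))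
    rw [← add_mul]
    exact mul_le_mul_of_nonneg_right (norm_add_le _ _) (by positivity)
  · simpa only [add_mul] using (hf.2 u hu).add (hg.2 u hu)

theorem DiscSeries.smul {f : K → K} {a : K} {c : ℕ → K} (hf : DiscSeries f a c) (t : K) :
    DiscSeries (fun z => t * f z) a (fun k => t * c k) := by
  refine ⟨fun r h0 h1 => ?_, fun u hu => ?_⟩
  · simpa only [norm_mul, mul_assoc] using (hf.1 r h0 h1).mul_left ‖t‖
  · simpa only [mul_assoc] using (hf.2 u hu).mul_left t

theorem DiscSeries.congr {f g : K → K} {a : K} {c : ℕ → K} (hf : DiscSeries f a c)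
    (h : ∀ z, ‖z - a‖ < 1 → f z = g z) : DiscSeries g a c :=
  ⟨hf.1, fun u hu => by rw [← h (a + u) (by simpa using hu)]; exact hf.2 u hu⟩

theorem DiscSeries.const (a t : K) : DiscSeries (fun _ => t) a (fun k => if k = 0 then t else 0) := by
  refine ⟨ConvOnDisc.of_bounded (B := ‖t‖) fun k => by split_ifs <;> simp, fun u _ => ?_⟩
  have := hasSum_ite_eq (α := K) 0 t
  refine this.congr_fun ?_ |> id
  intro k
  rcases eq_or_ne k 0 with rfl | hk <;> simp [*]

theorem DiscSeries.hasFPowerSeriesOnBall {f : K → K} {a : K} {c : ℕ → K}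
    (hf : DiscSeries f a c) :
    HasFPowerSeriesOnBall f (FormalMultilinearSeries.ofScalars K c) a 1 := by
  refine ⟨?_, one_pos, fun {u} hu => ?_⟩
  · refine ENNReal.le_of_forall_nnreal_lt fun r hr => ?_
    apply FormalMultilinearSeries.le_radius_of_summable
    have h1 : (r : ℝ) < 1 := by exact_mod_cast hr
    simpa [FormalMultilinearSeries.ofScalars_norm] using hf.1 r r.2 h1
  · have hu' : ‖u‖ < 1 := by
      rw [Metric.mem_eball, edist_zero_right, ← ofReal_norm, ENNReal.ofReal_lt_one] at hu
      exact hu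
    simpa [FormalMultilinearSeries.ofScalars_apply_eq, smul_eq_mul, mul_comm] using hf.2 u hu'

theorem DiscSeries.hasDerivAt {f : K → K} {a : K} {c : ℕ → K}
    (hf : DiscSeries f a c) : HasDerivAt f (c 1) a := by
  have := hf.hasFPowerSeriesOnBall.hasFPowerSeriesAt.hasDerivAt
  simpa [FormalMultilinearSeries.ofScalars_apply_eq] using this

theorem DiscSeries.eq_const [CompleteSpace K] [CharZero K] {f : K → K} {a : K} {c : ℕ → K}
    (hf : DiscSeries f a c) (hd : ∀ᶠ z in 𝓝 a, HasDerivAt f 0 z) :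
    ∀ z, ‖z - a‖ < 1 → f z = f a := by
  have hc : ∀ k, c (k + 1) = 0 := by
    intro k
    have h := hf.hasFPowerSeriesOnBall.factorial_smul 1 (k + 1)
    rw [← iteratedDeriv_eq_iteratedFDeriv, iteratedDeriv_succ'] at h
    have h0 : deriv f =ᶠ[𝓝 a] fun _ => 0 := by
      filter_upwards [hd] with z hz
      exact hz.deriv
    rw [h0.iteratedDeriv_eq] at h
    simpa [FormalMultilinearSeries.ofScalars_apply_eq, Nat.factorial_ne_zero] using h
  have key : ∀ u : K, ‖u‖ < 1 → f (a + u) = c 0 := by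
    intro u hu
    refine (hf.2 u hu).unique ?_
    convert hasSum_single (f := fun k => c k * u ^ k) 0 ?_ using 1
    · simp
    · rintro (_ | k) hk
      · exact absurd rfl hk
      · simp [hc]
  intro z hz
  have h1 := key (z - a) hz
  have h2 := key 0 (by simp)
  simp only [add_sub_cancel, add_zero] at h1 h2
  rw [h1, h2]

theorem norm_coeff_pow_mul_le [IsUltrametricDist K] {g : Polynomial K} {s r : ℝ} (hr0 : 0 ≤ r)
    (hr1 : r ≤ 1) (h0 : ‖g.coeff 0‖ ≤ s) (h1 : ∀ i, ‖g.coeff i‖ ≤ 1) (k j : ℕ) :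
    ‖(g ^ k).coeff j‖ * r ^ j ≤ (max s r) ^ k := by
  have hm : 0 ≤ max s r := le_max_of_le_right hr0
  induction k generalizing j with
  | zero =>
    rcases eq_or_ne j 0 with rfl | hj
    · simp
    · simp [Polynomial.coeff_one, hj]
  | succ k ih =>
    rw [pow_succ, Polynomial.coeff_mul]
    have hrj : r ^ j = ‖(1 : K)‖ * r ^ j := by simp
    rcases eq_or_lt_of_le (pow_nonneg hr0 j) with h | hpos
    · rw [← h]; simp; positivity
    rw [← le_div_iff₀ hpos]
    refine IsUltrametricDist.norm_sum_le_of_forall_le_of_nonneg (by positivity) ?_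
    rintro ⟨x, y⟩ hxy
    rw [Finset.HasAntidiagonal.mem_antidiagonal] at hxy
    simp only at hxy ⊢
    rw [le_div_iff₀ hpos, ← hxy, pow_add, norm_mul, pow_succ]
    calc ‖(g ^ k).coeff x‖ * ‖g.coeff y‖ * (r ^ x * r ^ y)
        = (‖(g ^ k).coeff x‖ * r ^ x) * (‖g.coeff y‖ * r ^ y) := by ring
      _ ≤ max s r ^ k * max s r := by
        refine mul_le_mul (ih x) ?_ (by positivity) (by positivity)
        rcases Nat.eq_zero_or_pos y with rfl | hy
        · simpa using Or.inl h0
        · refine le_max_of_le_right ?_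
          calc ‖g.coeff y‖ * r ^ y ≤ 1 * r ^ y :=
                mul_le_mul_of_nonneg_right (h1 y) (by positivity)
            _ ≤ r := by
              rw [one_mul]
              exact pow_le_of_le_one hr0 hr1 hy.ne'

theorem summable_comp_aux [IsUltrametricDist K] {c : ℕ → K} (hc : ConvOnDisc c) {g : Polynomial K}
    (h0 : ‖g.coeff 0‖ < 1) (h1 : ∀ i, ‖g.coeff i‖ ≤ 1) {r : ℝ} (hr0 : 0 ≤ r) (hr1 : r < 1) :
    Summable fun x : ℕ × ℕ => ‖c x.1‖ * (‖(g ^ x.1).coeff x.2‖ * r ^ x.2) := by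
  set ρ := max ‖g.coeff 0‖ r with hρ
  have hρ0 : 0 ≤ ρ := le_max_of_le_right hr0
  have hρ1 : ρ < 1 := max_lt h0 hr1
  have hz : ∀ k j, j ∉ Finset.range (k * g.natDegree + 1) → (g ^ k).coeff j = 0 := by
    intro k j hj
    refine Polynomial.coeff_eq_zero_of_natDegree_lt ?_
    refine lt_of_le_of_lt Polynomial.natDegree_pow_le ?_
    simpa [Nat.lt_succ_iff] using hj
  have hz' : ∀ k j, j ∉ Finset.range (k * g.natDegree + 1) →
      ‖c k‖ * (‖(g ^ k).coeff j‖ * r ^ j) = 0 := fun k j hj => by simp [hz k j hj]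
  rw [summable_prod_of_nonneg (fun x => by simp only [Pi.zero_apply]; positivity)]
  refine ⟨fun k => summable_of_ne_finset_zero (hz' k), ?_⟩
  have hS : Summable fun k : ℕ => (g.natDegree : ℝ) * ((k : ℝ) * (‖c k‖ * ρ ^ k)) + ‖c k‖ * ρ ^ k :=
    ((hc.mul_nat hρ0 hρ1).mul_left _).add (hc ρ hρ0 hρ1)
  refine Summable.of_nonneg_of_le (fun k => tsum_nonneg fun j => by positivity) (fun k => ?_) hS
  rw [tsum_eq_sum (hz' k)]
  refine (Finset.sum_le_card_nsmul _ _ (‖c k‖ * ρ ^ k) fun j _ => ?_).trans (le_of_eq ?_)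
  · exact mul_le_mul_of_nonneg_left (norm_coeff_pow_mul_le hr0 hr1.le le_rfl h1 k j) (norm_nonneg _)
  · simp; ring

theorem DiscSeries.comp [CompleteSpace K] [IsUltrametricDist K] {f : K → K} {a b : K} {c : ℕ → K}
    (hf : DiscSeries f b c) (g : Polynomial K) (h0 : ‖g.coeff 0‖ < 1)
    (h1 : ∀ i, ‖g.coeff i‖ ≤ 1) :
    DiscSeries (fun z => f (b + g.eval (z - a))) a
      (fun j => ∑' k, c k * (g ^ k).coeff j) := by
  have hlt : ∀ u : K, ‖u‖ < 1 → ‖g.eval u‖ < 1 := by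
    intro u hu
    rw [Polynomial.eval_eq_sum_range]
    refine lt_of_le_of_lt (IsUltrametricDist.norm_sum_le_of_forall_le_of_nonneg
      (C := max ‖g.coeff 0‖ ‖u‖) (by positivity) fun i _ => ?_) (max_lt h0 hu)
    have := norm_coeff_pow_mul_le (norm_nonneg u) hu.le le_rfl h1 1 i
    simpa [norm_mul, norm_pow] using this
  constructor
  · intro r hr0 hr1
    rcases eq_or_lt_of_le hr0 with rfl | hrpos
    · refine summable_of_ne_finset_zero (s := {0}) fun j hj => ?_
      have : j ≠ 0 := by simpa using hj
      simp [this]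
    have hs := summable_comp_aux hf.1 h0 h1 hr0 hr1
    have hs' := hs.prod_symm
    have hs2 := (summable_prod_of_nonneg
      (fun x => by simp only [Pi.zero_apply, Prod.fst_swap, Prod.snd_swap]; positivity)).1 hs'
    refine Summable.of_nonneg_of_le (fun j => by positivity) (fun j => ?_) hs2.2
    simp only [Prod.swap_prod_mk]
    have hj := hs2.1 j
    simp only [Prod.swap_prod_mk] at hj
    have hj' : Summable fun k => ‖c k * (g ^ k).coeff j‖ := by
      have := hj.mul_right (r ^ j)⁻¹
      refine this.congr fun k => ?_
      have : r ^ j ≠ 0 := by positivity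
      rw [norm_mul]; field_simp
    calc ‖∑' k, c k * (g ^ k).coeff j‖ * r ^ j
        ≤ (∑' k, ‖c k * (g ^ k).coeff j‖) * r ^ j :=
          mul_le_mul_of_nonneg_right (norm_tsum_le_tsum_norm hj') (by positivity)
      _ = ∑' k, ‖c k‖ * (‖(g ^ k).coeff j‖ * r ^ j) := by
          rw [← tsum_mul_right]; simp only [norm_mul, mul_assoc]
  · intro u hu
    have hs := summable_comp_aux hf.1 h0 h1 (norm_nonneg u) hu
    have hs' : Summable fun x : ℕ × ℕ => c x.1 * ((g ^ x.1).coeff x.2 * u ^ x.2) := by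
      refine Summable.of_norm ?_
      simpa only [norm_mul, norm_pow] using hs
    have hrow : ∀ k, HasSum (fun j => c k * ((g ^ k).coeff j * u ^ j)) (c k * (g.eval u) ^ k) := by
      intro k
      refine HasSum.mul_left _ ?_
      rw [← Polynomial.eval_pow, Polynomial.eval_eq_sum_range]
      refine hasSum_sum_of_ne_finset_zero fun j hj => ?_
      rw [Polynomial.coeff_eq_zero_of_natDegree_lt (by simpa [Nat.lt_succ_iff] using hj), zero_mul]
    have hv := hs'.hasSum.prod_fiberwise hrow
    have heq := hv.unique (hf.2 _ (hlt u hu))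
    have hcol := ((Equiv.prodComm ℕ ℕ).hasSum_iff.2 hs'.hasSum).prod_fiberwise
      (fun j => (((Equiv.prodComm ℕ ℕ).summable_iff.2 hs').prod_factor j).hasSum)
    rw [heq] at hcol
    simp only [Function.comp_apply, Equiv.prodComm_apply, Prod.swap_prod_mk] at hcol
    simp only [add_sub_cancel_left]
    refine hcol.congr_fun ?_ |> id
    intro j
    rw [← tsum_mul_right]
    simp only [mul_assoc]


theorem DiscSeries.recenter [CompleteSpace K] [IsUltrametricDist K] {f : K → K} {a b : K}
    {c : ℕ → K} (hf : DiscSeries f b c) (hab : ‖a - b‖ < 1) :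
    DiscSeries f a (fun j => ∑' k, c k * ((a - b) ^ (k - j) * (k.choose j : K))) := by
  have h := hf.comp (a := a) (Polynomial.X + Polynomial.C (a - b)) (by simpa using hab) ?_
  · simp only [Polynomial.coeff_X_add_C_pow] at h
    refine h.congr fun z _ => ?_
    simp
  · intro i
    rcases i with _ | _ | i
    · simpa using hab.le
    · simp
    · simp [Polynomial.coeff_X]

theorem norm_recenter_le [IsUltrametricDist K] {c : ℕ → K} {ε : ℝ} (hε : 0 ≤ ε)
    (hc : ∀ k, ‖c k‖ ≤ ε) {t : K} (ht : ‖t‖ < 1) (j : ℕ) :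
    ‖∑' k, c k * (t ^ (k - j) * (k.choose j : K))‖ ≤ ε := by
  refine IsUltrametricDist.norm_tsum_le_of_forall_le_of_nonneg hε fun k => ?_
  rw [norm_mul, norm_mul, norm_pow]
  have h1 : ‖t‖ ^ (k - j) ≤ 1 := pow_le_one₀ (norm_nonneg _) ht.le
  have h2 : ‖((k.choose j : ℕ) : K)‖ ≤ 1 := IsUltrametricDist.norm_natCast_le_one K _
  calc ‖c k‖ * (‖t‖ ^ (k - j) * ‖((k.choose j : ℕ) : K)‖) ≤ ε * (1 * 1) := by
        refine mul_le_mul (hc k) (mul_le_mul h1 h2 (norm_nonneg _) zero_le_one) (by positivity) hε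
    _ = ε := by ring

/-- The derivative of a function with a disc series. -/
theorem DiscSeries.hasDerivAt_tsum [CompleteSpace K] [IsUltrametricDist K] {f : K → K} {a : K}
    {c : ℕ → K} (hf : DiscSeries f a c) {u : K} (hu : ‖u‖ < 1) :
    HasDerivAt f (∑' k : ℕ, c k * (u ^ (k - 1) * (k : K))) (a + u) := by
  have h := (hf.recenter (a := a + u) (by simpa using hu)).hasDerivAt
  simpa using h

theorem DiscSeries.exists_hasDerivAt_le [CompleteSpace K] [IsUltrametricDist K] {f : K → K} {a : K}
    {c : ℕ → K} (hf : DiscSeries f a c) {ε : ℝ} (hε : 0 ≤ ε) (hc : ∀ k, ‖c k‖ ≤ ε) :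
    ∃ δ : K, ‖δ‖ ≤ ε ∧ HasDerivAt f δ a := ⟨c 1, hc 1, hf.hasDerivAt⟩

theorem DiscSeries.limit [CompleteSpace K] [IsUltrametricDist K] {h : ℕ → K → K} {H : K → K}
    {a : K} {e : ℕ → ℕ → K} {ε q : ℝ} (hε : 0 ≤ ε) (hq0 : 0 ≤ q) (hq1 : q < 1)
    (hh : ∀ l, DiscSeries (h l) a (e l)) (he : ∀ l k, ‖e l k‖ ≤ ε * q ^ l)
    (hH : ∀ z, ‖z - a‖ < 1 → HasSum (fun l => h l z) (H z)) :
    ∃ c, (∀ k, ‖c k‖ ≤ ε) ∧ DiscSeries H a c := by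
  have hb : ∀ k, ‖∑' l, e l k‖ ≤ ε := fun k =>
    IsUltrametricDist.norm_tsum_le_of_forall_le_of_nonneg hε fun l =>
      (he l k).trans (mul_le_of_le_one_right hε (pow_le_one₀ hq0 hq1.le))
  refine ⟨fun k => ∑' l, e l k, hb, ConvOnDisc.of_bounded hb, fun u hu => ?_⟩
  have hs : Summable fun x : ℕ × ℕ => e x.1 x.2 * u ^ x.2 := by
    refine Summable.of_norm_bounded (g := fun x : ℕ × ℕ => (ε * q ^ x.1) * ‖u‖ ^ x.2) ?_ fun x => ?_
    · exact ((summable_geometric_of_lt_one hq0 hq1).mul_left ε).mul_of_nonneg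
        (summable_geometric_of_lt_one (norm_nonneg u) hu) (fun l => by positivity)
        (fun k => by positivity)
    · rw [norm_mul, norm_pow]
      exact mul_le_mul_of_nonneg_right (he _ _) (by positivity)
  have hv := hs.hasSum.prod_fiberwise fun l => (hh l).2 u hu
  have heq := hv.unique (hH (a + u) (by simpa using hu))
  have hcol := ((Equiv.prodComm ℕ ℕ).hasSum_iff.2 hs.hasSum).prod_fiberwise
      (fun j => (((Equiv.prodComm ℕ ℕ).summable_iff.2 hs).prod_factor j).hasSum)
  rw [heq] at hcol
  simp only [Function.comp_apply, Equiv.prodComm_apply, Prod.swap_prod_mk] at hcol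
  simpa only [← tsum_mul_right] using hcol

theorem norm_coeff_X_add_C_pow_le [IsUltrametricDist K] {a : K} (ha : ‖a‖ ≤ 1) (n j : ℕ) :
    ‖((Polynomial.X + Polynomial.C a) ^ n).coeff j‖ ≤ 1 := by
  rw [Polynomial.coeff_X_add_C_pow, norm_mul, norm_pow]
  exact mul_le_one₀ (pow_le_one₀ (norm_nonneg _) ha) (norm_nonneg _)
    (IsUltrametricDist.norm_natCast_le_one K _)

theorem norm_coeff_inv_le [IsUltrametricDist K] {φ : PowerSeries K}
    (h0 : ‖PowerSeries.constantCoeff φ‖ = 1) (h1 : ∀ k, ‖PowerSeries.coeff k φ‖ ≤ 1) (k : ℕ) :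
    ‖PowerSeries.coeff k φ⁻¹‖ ≤ 1 := by
  induction k using Nat.strong_induction_on with
  | _ k ih =>
    rw [PowerSeries.coeff_inv]
    split_ifs with hk
    · rw [norm_inv, h0, inv_one]
    · rw [norm_mul, norm_neg, norm_inv, h0, inv_one, one_mul]
      refine IsUltrametricDist.norm_sum_le_of_forall_le_of_nonneg zero_le_one ?_
      rintro x -
      split_ifs with hx
      · rw [norm_mul]
        exact mul_le_one₀ (h1 _) (norm_nonneg _) (ih _ hx)
      · simp

theorem discSeries_ratio [CompleteSpace K] [IsUltrametricDist K] (P Q : Polynomial K) (a : K)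
    {ε : ℝ} (hε : 0 ≤ ε) (hP : ∀ i, ‖P.coeff i‖ ≤ ε) (hQ : ∀ i, ‖Q.coeff i‖ ≤ 1)
    (hQ0 : ‖Q.coeff 0‖ = 1) (hQu : ∀ u, ‖u‖ < 1 → Q.eval u ≠ 0) :
    ∃ c : ℕ → K, (∀ k, ‖c k‖ ≤ ε) ∧
      DiscSeries (fun z => P.eval (z - a) / Q.eval (z - a)) a c := by
  set F : PowerSeries K := (P : PowerSeries K) * (Q : PowerSeries K)⁻¹ with hF
  have hinv : ∀ k, ‖PowerSeries.coeff k (Q : PowerSeries K)⁻¹‖ ≤ 1 :=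
    norm_coeff_inv_le (by simpa using hQ0) (by simpa using hQ)
  have hFb : ∀ k, ‖PowerSeries.coeff k F‖ ≤ ε := by
    intro k
    rw [hF, PowerSeries.coeff_mul]
    refine IsUltrametricDist.norm_sum_le_of_forall_le_of_nonneg hε fun x _ => ?_
    rw [norm_mul, Polynomial.coeff_coe]
    calc _ ≤ ε * 1 := mul_le_mul (hP _) (hinv _) (norm_nonneg _) hε
      _ = ε := mul_one _
  have hFQ : F * (Q : PowerSeries K) = P := by
    rw [hF, mul_assoc, PowerSeries.inv_mul_cancel, mul_one]
    have : Q.coeff 0 ≠ 0 := by rw [← norm_pos_iff, hQ0]; exact one_pos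
    simpa using this
  have hconv := ConvOnDisc.of_bounded hFb
  refine ⟨fun k => PowerSeries.coeff k F, hFb, hconv, fun u hu => ?_⟩
  have hsF : Summable fun k => ‖PowerSeries.coeff k F * u ^ k‖ := by
    simpa only [norm_mul, norm_pow] using hconv ‖u‖ (norm_nonneg u) hu
  have hev : ∀ R : Polynomial K, HasSum (fun k => R.coeff k * u ^ k) (R.eval u) := by
    intro R
    rw [Polynomial.eval_eq_sum_range]
    refine hasSum_sum_of_ne_finset_zero fun j hj => ?_
    rw [Polynomial.coeff_eq_zero_of_natDegree_lt (by simpa [Nat.lt_succ_iff] using hj), zero_mul]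
  have hsQ : Summable fun k => ‖Q.coeff k * u ^ k‖ := by
    refine summable_of_ne_finset_zero (s := Finset.range (Q.natDegree + 1)) fun j hj => ?_
    rw [Polynomial.coeff_eq_zero_of_natDegree_lt (by simpa [Nat.lt_succ_iff] using hj), zero_mul,
      norm_zero]
  have hm := tsum_mul_tsum_eq_tsum_sum_antidiagonal_of_summable_norm hsF hsQ
  rw [(hev Q).tsum_eq] at hm
  have hP' : ∀ k, ∑ kl ∈ Finset.HasAntidiagonal.antidiagonal k,
      PowerSeries.coeff kl.1 F * u ^ kl.1 * (Q.coeff kl.2 * u ^ kl.2) = P.coeff k * u ^ k := by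
    intro k
    rw [← Polynomial.coeff_coe P k, ← hFQ, PowerSeries.coeff_mul, Finset.sum_mul]
    refine Finset.sum_congr rfl fun x hx => ?_
    rw [Finset.HasAntidiagonal.mem_antidiagonal] at hx
    rw [← hx, pow_add, Polynomial.coeff_coe]
    ring
  simp only [hP', (hev P).tsum_eq] at hm
  simp only [add_sub_cancel_left]
  rw [← hm, mul_div_cancel_right₀ _ (hQu u hu)]
  exact hsF.of_norm.hasSum

end PowerSeriesOnDiscs

section Measure

variable {p : ℕ} [Fact p.Prime] {K : Type*} [NontriviallyNormedField K] [NormedAlgebra ℚ_[p] K]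
  [IsUltrametricDist K]

theorem norm_natCast_eq (k : ℕ) : ‖(k : K)‖ = ‖(k : ℚ_[p])‖ := by
  rw [← map_natCast (algebraMap ℚ_[p] K) k, norm_algebraMap']

theorem norm_p_pow (m : ℕ) : ‖((p ^ m : ℕ) : K)‖ = ((p : ℝ)⁻¹) ^ m := by
  rw [norm_natCast_eq (p := p)]
  push_cast
  rw [norm_pow, Padic.norm_p]

theorem inv_p_lt_one : ((p : ℝ)⁻¹) < 1 :=
  inv_lt_one_of_one_lt₀ (by exact_mod_cast (Fact.out : p.Prime).one_lt)

theorem norm_pow_sub_pow_le {x y : K} (hx : ‖x‖ ≤ 1) (hy : ‖y‖ ≤ 1) (n : ℕ) :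
    ‖x ^ n - y ^ n‖ ≤ ‖x - y‖ := by
  rw [← (Commute.all x y).geom_sum₂_mul, norm_mul]
  refine mul_le_of_le_one_left (norm_nonneg _) ?_
  refine IsUltrametricDist.norm_sum_le_of_forall_le_of_nonneg zero_le_one fun i _ => ?_
  rw [norm_mul, norm_pow, norm_pow]
  exact mul_le_one₀ (pow_le_one₀ (norm_nonneg _) hx) (by positivity)
    (pow_le_one₀ (norm_nonneg _) hy)

theorem norm_sub_le_max' (x y : K) : ‖x - y‖ ≤ max ‖x‖ ‖y‖ := by
  rw [sub_eq_add_neg, ← norm_neg y]; exact IsUltrametricDist.norm_add_le_max _ _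

variable (p) in
theorem norm_pow_p_sub_lt_iff {x y : K} (hx : ‖x‖ ≤ 1) (hy : ‖y‖ ≤ 1) :
    ‖x ^ p - y ^ p‖ < 1 ↔ ‖x - y‖ < 1 := by
  have hp : p.Prime := Fact.out
  refine ⟨fun h => ?_, fun h => lt_of_le_of_lt (norm_pow_sub_pow_le hx hy p) h⟩
  have hxy : ‖x - y‖ ≤ 1 := (norm_sub_le_max' x y).trans (max_le hx hy)
  have key := add_pow_prime_eq hp (x - y) y
  rw [sub_add_cancel] at key
  set T : K := ∑ k ∈ Finset.Ioo 0 p, (x - y) ^ (k - 1) * y ^ (p - k - 1) * ((p.choose k / p : ℕ) : K)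
    with hT
  have hTn : ‖T‖ ≤ 1 := by
    refine IsUltrametricDist.norm_sum_le_of_forall_le_of_nonneg zero_le_one fun i _ => ?_
    rw [norm_mul, norm_mul, norm_pow, norm_pow]
    exact mul_le_one₀ (mul_le_one₀ (pow_le_one₀ (norm_nonneg _) hxy) (by positivity)
      (pow_le_one₀ (norm_nonneg _) hy)) (norm_nonneg _) (IsUltrametricDist.norm_natCast_le_one K _)
  have h2 : ‖(p : K) * (x - y) * y * T‖ < 1 := by
    have hpn : ‖(p : K)‖ < 1 := by
      have := norm_p_pow (p := p) (K := K) 1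
      rw [pow_one, pow_one] at this
      rw [this]; exact inv_p_lt_one
    rw [mul_assoc, mul_assoc, norm_mul]
    refine lt_of_le_of_lt (mul_le_of_le_one_right (norm_nonneg _) ?_) hpn
    rw [norm_mul, norm_mul]
    exact mul_le_one₀ hxy (by positivity) (mul_le_one₀ hy (norm_nonneg _) hTn)
  have h3 : (x - y) ^ p = (x ^ p - y ^ p) - (p : K) * (x - y) * y * T := by
    rw [key]; ring
  have h4 : ‖x - y‖ ^ p < 1 := by
    rw [← norm_pow, h3]
    exact lt_of_le_of_lt (norm_sub_le_max' _ _) (max_lt h h2)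
  exact (pow_lt_one_iff_of_nonneg (norm_nonneg _) hp.ne_zero).1 h4

theorem norm_one_sub_of_mem {z : K} : z ∈ affinoid K ↔ ‖z‖ ≤ 1 ∧ ¬ ‖z - 1‖ < 1 := by
  simp [affinoid]

variable (p) in
theorem pow_mem_affinoid {z : K} (hz : z ∈ affinoid K) : z ^ p ∈ affinoid K := by
  rw [norm_one_sub_of_mem] at hz ⊢
  refine ⟨by rw [norm_pow]; exact pow_le_one₀ (norm_nonneg _) hz.1, ?_⟩
  have := norm_pow_p_sub_lt_iff p hz.1 (y := 1) (by simp)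
  rw [one_pow] at this
  rw [this]; exact hz.2

variable (p) in
theorem pow_pow_mem_affinoid {z : K} (hz : z ∈ affinoid K) (m : ℕ) : z ^ p ^ m ∈ affinoid K := by
  induction m with
  | zero => simpa using hz
  | succ m ih => rw [pow_succ, pow_mul]; exact pow_mem_affinoid p ih

theorem norm_one_sub_eq {z : K} (hz : z ∈ affinoid K) : ‖1 - z‖ = 1 := by
  refine le_antisymm ((norm_sub_le_max' _ _).trans (max_le (by simp) hz.1)) ?_
  rw [norm_sub_rev]; exact hz.2

theorem mem_affinoid_of_close {a z : K} (ha : a ∈ affinoid K) (h : ‖z - a‖ < 1) :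
    z ∈ affinoid K := by
  rw [norm_one_sub_of_mem] at *
  constructor
  · have : z = (z - a) + a := by ring
    rw [this]; exact (IsUltrametricDist.norm_add_le_max _ _).trans (max_le h.le ha.1)
  · intro h1
    apply ha.2
    have : a - 1 = (z - 1) - (z - a) := by ring
    rw [this]; exact lt_of_le_of_lt (norm_sub_le_max' _ _) (max_lt h1 h)

/-- A finite combination of the functions `z ^ i / (1 - z ^ p ^ m)`. -/
def combo (p : ℕ) (ψ : ℕ → K) (M m : ℕ) (z : K) : K :=
  (∑ i ∈ Finset.range M, ψ i * z ^ i) / (1 - z ^ p ^ m)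

theorem norm_combo_le {ψ : ℕ → K} {ε : ℝ} (hε : 0 ≤ ε) {M : ℕ} (hψ : ∀ i < M, ‖ψ i‖ ≤ ε) (m : ℕ)
    {z : K} (hz : z ∈ affinoid K) : ‖combo p ψ M m z‖ ≤ ε := by
  rw [combo, norm_div, norm_one_sub_eq (pow_pow_mem_affinoid p hz m), div_one]
  refine IsUltrametricDist.norm_sum_le_of_forall_le_of_nonneg hε fun i hi => ?_
  rw [norm_mul, norm_pow]
  exact (mul_le_of_le_one_right (norm_nonneg _) (pow_le_one₀ (norm_nonneg _) hz.1)).trans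
    (hψ i (Finset.mem_range.1 hi))

theorem discSeries_combo [CompleteSpace K] {ψ : ℕ → K} {ε : ℝ} (hε : 0 ≤ ε) {M : ℕ}
    (hψ : ∀ i < M, ‖ψ i‖ ≤ ε) (m : ℕ) {a : K} (ha : a ∈ affinoid K) :
    ∃ c : ℕ → K, (∀ k, ‖c k‖ ≤ ε) ∧ DiscSeries (combo p ψ M m) a c := by
  have main := discSeries_ratio
    (∑ i ∈ Finset.range M, Polynomial.C (ψ i) * (Polynomial.X + Polynomial.C a) ^ i)
    (1 - (Polynomial.X + Polynomial.C a) ^ p ^ m) a hε ?_ ?_ ?_ ?_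
  · obtain ⟨c, hc, h⟩ := main
    refine ⟨c, hc, h.congr fun z _ => ?_⟩
    simp [combo, Polynomial.eval_finsetSum]
  · intro j
    rw [Polynomial.finsetSum_coeff]
    refine IsUltrametricDist.norm_sum_le_of_forall_le_of_nonneg hε fun i hi => ?_
    rw [Polynomial.coeff_C_mul, norm_mul]
    exact (mul_le_of_le_one_right (norm_nonneg _) (norm_coeff_X_add_C_pow_le ha.1 _ _)).trans
      (hψ i (Finset.mem_range.1 hi))
  · intro j
    rw [Polynomial.coeff_sub]
    refine (norm_sub_le_max' _ _).trans (max_le ?_ (norm_coeff_X_add_C_pow_le ha.1 _ _))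
    rw [Polynomial.coeff_one]; split_ifs <;> simp
  · rw [Polynomial.coeff_sub, Polynomial.coeff_X_add_C_pow]
    simpa using norm_one_sub_eq (pow_pow_mem_affinoid p ha m)
  · intro u hu
    have hmem : u + a ∈ affinoid K := mem_affinoid_of_close ha (by simpa using hu)
    have := norm_one_sub_eq (pow_pow_mem_affinoid p hmem m)
    rw [← norm_ne_zero_iff]
    simp [this]

/-- The function `i ↦ i ^ (-n)` on integers prime to `p`, extended by zero. -/
def primeToPow (p : ℕ) (K : Type*) [NormedField K] (n i : ℕ) : K :=
  if p ∣ i then 0 else ((i : K) ^ n)⁻¹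

theorem norm_primeToPow_le (n i : ℕ) : ‖primeToPow p K n i‖ ≤ 1 := by
  unfold primeToPow
  split_ifs with h
  · simp
  · rw [norm_inv, norm_pow, norm_natCast_eq (p := p),
      (Padic.norm_natCast_eq_one_iff).2 ((Nat.Prime.coprime_iff_not_dvd Fact.out).2 h)]
    simp

theorem norm_primeToPow_sub_le (n m i : ℕ) :
    ‖primeToPow p K n i - primeToPow p K n (i % p ^ m)‖ ≤ ((p : ℝ)⁻¹) ^ m := by
  rcases Nat.eq_zero_or_pos m with rfl | hm
  · rw [pow_zero]
    exact (norm_sub_le_max' _ _).trans (max_le (norm_primeToPow_le n i) (norm_primeToPow_le n _))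
  have hd : p ∣ i % p ^ m ↔ p ∣ i := Nat.dvd_mod_iff (dvd_pow_self p hm.ne')
  by_cases h : p ∣ i
  · simp only [primeToPow, hd, h, if_true, sub_self, norm_zero]
    positivity
  have hu : ∀ j : ℕ, ¬ p ∣ j → ‖(j : K)‖ = 1 := fun j hj => by
    rw [norm_natCast_eq (p := p)]
    exact (Padic.norm_natCast_eq_one_iff).2 ((Nat.Prime.coprime_iff_not_dvd Fact.out).2 hj)
  have h' : ¬ p ∣ i % p ^ m := by rwa [hd]
  simp only [primeToPow, h', h, if_false]
  have hi := hu i h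
  have hi' := hu _ h'
  have hi0 : ((i : ℕ) : K) ≠ 0 := by rw [← norm_ne_zero_iff, hi]; simp
  have hi0' : ((i % p ^ m : ℕ) : K) ≠ 0 := by rw [← norm_ne_zero_iff, hi']; simp
  rw [inv_sub_inv (pow_ne_zero _ hi0) (pow_ne_zero _ hi0'), norm_div, norm_mul, norm_pow, norm_pow,
    hi, hi', one_pow, mul_one, div_one]
  refine (norm_pow_sub_pow_le hi'.le hi.le n).trans ?_
  have hdiv : (i : K) = ((i % p ^ m : ℕ) : K) + ((p ^ m : ℕ) : K) * ((i / p ^ m : ℕ) : K) := by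
    rw [← Nat.cast_mul, ← Nat.cast_add, Nat.mod_add_div]
  rw [norm_sub_rev]
  conv_lhs => rw [hdiv]
  rw [add_sub_cancel_left, norm_mul, norm_p_pow]
  exact mul_le_of_le_one_right (by positivity) (IsUltrametricDist.norm_natCast_le_one K _)

theorem sum_periodic (χ : ℕ → K) (N t : ℕ) (z : K) :
    ∑ i ∈ Finset.range (N * t), χ (i % N) * z ^ i =
      (∑ i ∈ Finset.range N, χ i * z ^ i) * ∑ s ∈ Finset.range t, (z ^ N) ^ s := by
  induction t with
  | zero => simp
  | succ t ih =>
    rw [Nat.mul_succ, Finset.sum_range_add (M := K) (fun i => χ (i % N) * z ^ i), ih,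
      Finset.sum_range_succ _ t, mul_add]
    congr 1
    rw [Finset.sum_mul]
    refine Finset.sum_congr rfl fun i hi => ?_
    rw [Nat.mul_add_mod, Nat.mod_eq_of_lt (Finset.mem_range.1 hi), pow_add, pow_mul]
    ring

/-- The Riemann sums `∑ i ^ (-n) * z ^ i / (1 - z ^ p ^ m)` over `i < p ^ m` prime to `p`. -/
def riemannSum (p : ℕ) {K : Type*} [NontriviallyNormedField K] (n m : ℕ) : K → K :=
  combo p (primeToPow p K n) (p ^ m) m

/-- The differences of consecutive Riemann sums, in closed form. -/
def riemannDiff (p : ℕ) {K : Type*} [NontriviallyNormedField K] (n m : ℕ) : K → K :=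
  combo p (fun i => primeToPow p K n i - primeToPow p K n (i % p ^ m)) (p ^ (m + 1)) (m + 1)

theorem riemannSum_succ (n m : ℕ) {z : K} (hz : z ∈ affinoid K) :
    riemannSum p n (m + 1) z = riemannSum p n m z + riemannDiff p n m z := by
  have h1 : (1 : K) - z ^ p ^ m ≠ 0 := by
    rw [← norm_ne_zero_iff, norm_one_sub_eq (pow_pow_mem_affinoid p hz m)]; simp
  have h2 : (1 : K) - z ^ p ^ (m + 1) ≠ 0 := by
    rw [← norm_ne_zero_iff, norm_one_sub_eq (pow_pow_mem_affinoid p hz (m + 1))]; simp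
  have hper := sum_periodic (primeToPow p K n) (p ^ m) p z
  have hgeo := mul_neg_geom_sum (z ^ p ^ m) p
  rw [← pow_mul, ← pow_succ] at hgeo
  rw [← pow_succ] at hper
  simp only [riemannSum, riemannDiff, combo, sub_mul, Finset.sum_sub_distrib]
  rw [hper, ← hgeo]
  rw [← hgeo] at h2
  have h3 := right_ne_zero_of_mul h2
  field_simp
  ring

variable (p) in
/-- The limit of the Riemann sums. -/
def riemannLimit {K : Type*} [NontriviallyNormedField K] (n : ℕ) (z : K) : K :=
  ∑' l, riemannDiff p n l z

theorem norm_riemannDiff_le (n m : ℕ) {z : K} (hz : z ∈ affinoid K) :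
    ‖riemannDiff p n m z‖ ≤ ((p : ℝ)⁻¹) ^ m :=
  norm_combo_le (by positivity) (fun i _ => norm_primeToPow_sub_le n m i) _ hz

theorem riemannSum_zero (n : ℕ) (z : K) : riemannSum p n 0 z = 0 := by
  simp [riemannSum, combo, primeToPow]

theorem riemannSum_eq_sum (n m : ℕ) {z : K} (hz : z ∈ affinoid K) :
    riemannSum p n m z = ∑ l ∈ Finset.range m, riemannDiff p n l z := by
  induction m with
  | zero => simp [riemannSum_zero]
  | succ m ih => rw [riemannSum_succ n m hz, ih, Finset.sum_range_succ]

theorem summable_riemannDiff [CompleteSpace K] (n : ℕ) {z : K} (hz : z ∈ affinoid K) :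
    Summable fun l => riemannDiff p n l z :=
  Summable.of_norm_bounded (summable_geometric_of_lt_one (by positivity) inv_p_lt_one)
    fun l => norm_riemannDiff_le n l hz

theorem hasSum_riemannDiff [CompleteSpace K] (n m : ℕ) {z : K} (hz : z ∈ affinoid K) :
    HasSum (fun l => riemannDiff p n (m + l) z) (riemannLimit p n z - riemannSum p n m z) := by
  rw [riemannSum_eq_sum n m hz, riemannLimit]
  simp_rw [add_comm m]
  exact (hasSum_nat_add_iff' m).2 (summable_riemannDiff n hz).hasSum

theorem norm_riemannLimit_sub_le [CompleteSpace K] (n m : ℕ) {z : K} (hz : z ∈ affinoid K) :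
    ‖riemannLimit p n z - riemannSum p n m z‖ ≤ ((p : ℝ)⁻¹) ^ m := by
  rw [← (hasSum_riemannDiff n m hz).tsum_eq]
  refine IsUltrametricDist.norm_tsum_le_of_forall_le_of_nonneg (by positivity) fun l => ?_
  refine (norm_riemannDiff_le n _ hz).trans ?_
  exact pow_le_pow_of_le_one (by positivity) inv_p_lt_one.le (Nat.le_add_right m l)

theorem discSeries_limit_sub [CompleteSpace K] (n m : ℕ) {a : K} (ha : a ∈ affinoid K) :
    ∃ c : ℕ → K, (∀ k, ‖c k‖ ≤ ((p : ℝ)⁻¹) ^ m) ∧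
      DiscSeries (fun z => riemannLimit p n z - riemannSum p n m z) a c := by
  choose e he he' using fun l : ℕ => discSeries_combo (p := p) (K := K) (ε := ((p : ℝ)⁻¹) ^ (m + l))
    (by positivity)
    (fun i (_ : i < p ^ (m + l + 1)) => norm_primeToPow_sub_le (K := K) n (m + l) i) (m + l + 1) ha
  refine DiscSeries.limit (h := fun l => riemannDiff p n (m + l)) (e := e) (q := (p : ℝ)⁻¹)
    (by positivity) (by positivity) inv_p_lt_one he' (fun l k => ?_) fun z hz => ?_
  · rw [← pow_add]; exact he l k
  · exact hasSum_riemannDiff n m (mem_affinoid_of_close ha hz)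

theorem discSeries_riemannLimit [CompleteSpace K] (n : ℕ) {a : K} (ha : a ∈ affinoid K) :
    ∃ c : ℕ → K, DiscSeries (riemannLimit p n) a c := by
  obtain ⟨c, -, h⟩ := discSeries_limit_sub (p := p) n 0 ha
  exact ⟨c, h.congr fun z _ => by simp [riemannSum_zero]⟩

theorem exists_hasDerivAt_riemannSum (n m : ℕ) {z : K} (hz : z ∈ affinoid K) :
    ∃ D : K, HasDerivAt (riemannSum p (n + 1) m) D z ∧
      ‖z * D - riemannSum p n m z‖ ≤ ((p : ℝ)⁻¹) ^ m := by
  have h1 : (1 : K) - z ^ p ^ m ≠ 0 := by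
    rw [← norm_ne_zero_iff, norm_one_sub_eq (pow_pow_mem_affinoid p hz m)]; simp
  set A : K := ∑ i ∈ Finset.range (p ^ m), primeToPow p K (n + 1) i * z ^ i with hA
  set A' : K := ∑ i ∈ Finset.range (p ^ m), primeToPow p K (n + 1) i * (i * z ^ (i - 1)) with hA'
  have dA : HasDerivAt (fun z : K => ∑ i ∈ Finset.range (p ^ m), primeToPow p K (n + 1) i * z ^ i)
      A' z := by
    rw [hA']
    refine HasDerivAt.fun_sum fun i _ => ?_
    exact (hasDerivAt_pow i z).const_mul _
  have dB : HasDerivAt (fun z : K => 1 - z ^ p ^ m) (-(((p ^ m : ℕ) : K) * z ^ (p ^ m - 1))) z :=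
    (hasDerivAt_pow (p ^ m) z).const_sub 1
  have hzA : z * A' = ∑ i ∈ Finset.range (p ^ m), primeToPow p K n i * z ^ i := by
    rw [hA', Finset.mul_sum]
    refine Finset.sum_congr rfl fun i _ => ?_
    unfold primeToPow
    split_ifs with hpi
    · simp
    · have hi : i ≠ 0 := fun h => hpi (h ▸ dvd_zero p)
      have hi0 : (i : K) ≠ 0 := by
        rw [← norm_ne_zero_iff, norm_natCast_eq (p := p)]
        simpa using hi
      obtain ⟨j, rfl⟩ := Nat.exists_eq_succ_of_ne_zero hi
      rw [Nat.succ_sub_one]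
      rw [Nat.succ_eq_add_one] at *
      field_simp
      ring
  refine ⟨_, dA.fun_div dB h1, ?_⟩
  have hN : p ^ m ≠ 0 := pow_ne_zero _ (Fact.out : p.Prime).ne_zero
  have hzN : z * z ^ (p ^ m - 1) = z ^ p ^ m := by
    rw [← pow_succ', Nat.sub_add_cancel (Nat.one_le_iff_ne_zero.2 hN)]
  have hE : z * ((A' * (1 - z ^ p ^ m) - A * -(((p ^ m : ℕ) : K) * z ^ (p ^ m - 1))) /
      (1 - z ^ p ^ m) ^ 2) - riemannSum p n m z =
      ((p ^ m : ℕ) : K) * (A * z ^ p ^ m / (1 - z ^ p ^ m) ^ 2) := by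
    rw [riemannSum, combo, ← hzA]
    field_simp
    linear_combination (A * ((p ^ m : ℕ) : K)) * hzN
  rw [hE, norm_mul, norm_p_pow]
  refine mul_le_of_le_one_right (by positivity) ?_
  have hAn : ‖A‖ ≤ 1 := by
    refine IsUltrametricDist.norm_sum_le_of_forall_le_of_nonneg zero_le_one fun i _ => ?_
    rw [norm_mul, norm_pow]
    exact mul_le_one₀ (norm_primeToPow_le _ _) (by positivity) (pow_le_one₀ (norm_nonneg _) hz.1)
  rw [norm_div, norm_pow, norm_one_sub_eq (pow_pow_mem_affinoid p hz m), one_pow, div_one, norm_mul,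
    norm_pow]
  exact mul_le_one₀ hAn (by positivity) (pow_le_one₀ (norm_nonneg _) hz.1)

theorem hasDerivAt_riemannLimit [CompleteSpace K] (n : ℕ) {z : K} (hz : z ∈ affinoid K)
    (hz0 : z ≠ 0) : HasDerivAt (riemannLimit p (n + 1)) (riemannLimit p n z / z) z := by
  have key : ∀ m : ℕ, ∃ D : K, HasDerivAt (riemannLimit p (n + 1)) D z ∧
      ‖z * D - riemannLimit p n z‖ ≤ ((p : ℝ)⁻¹) ^ m := by
    intro m
    obtain ⟨D, hD, hDn⟩ := exists_hasDerivAt_riemannSum (p := p) n m hz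
    obtain ⟨c, hc, h⟩ := discSeries_limit_sub (p := p) (n + 1) m hz
    obtain ⟨δ, hδ, hδ'⟩ := h.exists_hasDerivAt_le (by positivity) hc
    refine ⟨δ + D, by simpa using hδ'.fun_add hD, ?_⟩
    have : z * (δ + D) - riemannLimit p n z = z * δ + ((z * D - riemannSum p n m z) -
      (riemannLimit p n z - riemannSum p n m z)) := by ring
    rw [this]
    refine (IsUltrametricDist.norm_add_le_max _ _).trans (max_le ?_ ?_)
    · rw [norm_mul]
      exact (mul_le_of_le_one_left (norm_nonneg _) hz.1).trans hδ
    · exact (norm_sub_le_max' _ _).trans (max_le hDn (norm_riemannLimit_sub_le n m hz))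
  obtain ⟨D, hD, -⟩ := key 0
  have h0 : ‖z * D - riemannLimit p n z‖ ≤ 0 := by
    refine ge_of_tendsto' (tendsto_pow_atTop_nhds_zero_of_lt_one (r := (p : ℝ)⁻¹) (by positivity)
      inv_p_lt_one) fun m => ?_
    obtain ⟨D', hD', h'⟩ := key m
    rwa [hD.unique hD']
  have h1 : z * D = riemannLimit p n z := sub_eq_zero.1 (norm_le_zero_iff.1 h0)
  rw [← h1, mul_div_cancel_left₀ _ hz0]
  exact hD

theorem riemannLimit_zero_right (n : ℕ) : riemannLimit p n (0 : K) = 0 := by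
  have : ∀ l, riemannDiff p n l (0 : K) = 0 := by
    intro l
    have hs : ∀ ψ : ℕ → K, ψ 0 = 0 → ∀ M, ∑ i ∈ Finset.range M, ψ i * (0 : K) ^ i = 0 := by
      intro ψ hψ M
      refine Finset.sum_eq_zero fun i _ => ?_
      rcases eq_or_ne i 0 with rfl | hi
      · simp [hψ]
      · simp [hi]
    rw [riemannDiff, combo, hs _ (by simp [primeToPow]), zero_div]
  simp [riemannLimit, this]

theorem riemannLimit_zero_left [CompleteSpace K] {z : K} (hz : z ∈ affinoid K) :
    riemannLimit p 0 z = z / (1 - z) - z ^ p / (1 - z ^ p) := by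
  have hp : p.Prime := Fact.out
  have h1 : (1 : K) - z ≠ 0 := by
    rw [← norm_ne_zero_iff, norm_one_sub_eq hz]; simp
  have h2 : (1 : K) - z ^ p ≠ 0 := by
    rw [← norm_ne_zero_iff, norm_one_sub_eq (pow_mem_affinoid p hz)]; simp
  have hd : ∀ l, riemannDiff p 0 (1 + l) z = 0 := by
    intro l
    have : ∀ i, primeToPow p K 0 i - primeToPow p K 0 (i % p ^ (1 + l)) = 0 := by
      intro i
      have hd : p ∣ i % p ^ (1 + l) ↔ p ∣ i := Nat.dvd_mod_iff (dvd_pow_self p (by omega))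
      simp [primeToPow, hd]
    simp [riemannDiff, combo, this]
  have h := hasSum_riemannDiff (p := p) 0 1 hz
  simp only [hd] at h
  have h3 : riemannLimit p 0 z = riemannSum p 0 1 z :=
    sub_eq_zero.1 (h.unique hasSum_zero)
  rw [h3, riemannSum, combo, pow_one]
  have hs : ∑ i ∈ Finset.range p, primeToPow p K 0 i * z ^ i
      = (∑ i ∈ Finset.range p, z ^ i) - 1 := by
    obtain ⟨q, rfl⟩ : ∃ q, p = q + 1 := ⟨p - 1, (Nat.succ_pred_prime hp).symm⟩
    rw [Finset.sum_range_succ', Finset.sum_range_succ' (fun i => z ^ i)]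
    simp only [pow_zero, mul_one, add_sub_cancel_right]
    have : primeToPow (q + 1) K 0 0 = 0 := by simp [primeToPow]
    rw [this, add_zero]
    refine Finset.sum_congr rfl fun i hi => ?_
    have : ¬ (q + 1) ∣ (i + 1) :=
      Nat.not_dvd_of_pos_of_lt (Nat.succ_pos i) (by simpa using hi)
    simp [primeToPow, this]
  have hg := mul_neg_geom_sum z p
  rw [hs]
  have hg' : ∑ i ∈ Finset.range p, z ^ i = (1 - z ^ p) / (1 - z) := by
    rw [eq_div_iff h1, mul_comm]; exact hg
  rw [hg']
  field_simp
  ring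

end Measure
section Existence

variable {p : ℕ} [Fact p.Prime] {K : Type*} [NontriviallyNormedField K] [NormedAlgebra ℚ_[p] K]
  [IsUltrametricDist K] [CompleteSpace K]

theorem norm_inv_natCast_le (p : ℕ) [Fact p.Prime] {K : Type*} [NontriviallyNormedField K]
    [NormedAlgebra ℚ_[p] K] [IsUltrametricDist K] [CompleteSpace K] (k : ℕ) : ‖((k : K))⁻¹‖ ≤ k := by
  rcases Nat.eq_zero_or_pos k with rfl | hk
  · simp
  rw [norm_inv, norm_natCast_eq (p := p)]
  have h1 : ((k : ℝ))⁻¹ ≤ ‖(k : ℚ_[p])‖ := by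
    rw [Padic.norm_eq_zpow_neg_valuation (by exact_mod_cast hk.ne'), Padic.valuation_natCast,
      zpow_neg, zpow_natCast]
    refine inv_anti₀ (by have := (Fact.out : p.Prime).pos; positivity) ?_
    exact_mod_cast Nat.le_of_dvd hk pow_padicValNat_dvd
  have hk' : (0 : ℝ) < k := by exact_mod_cast hk
  rw [inv_le_comm₀ (lt_of_lt_of_le (by positivity) h1) hk']
  exact h1

theorem exists_primitive_aux (p : ℕ) [Fact p.Prime] {K : Type*} [NontriviallyNormedField K]
    [NormedAlgebra ℚ_[p] K] [IsUltrametricDist K] [CompleteSpace K] (a : K) {e : ℕ → K} (he0 : e 0 = 0) (he : ConvOnDisc e) :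
    ∃ (F : K → K) (d : ℕ → K), DiscSeries F a d ∧ ∀ u : K, ‖u‖ < 1 →
      ∃ D, HasDerivAt F D (a + u) ∧ HasSum (fun k => e (k + 1) * u ^ k) D := by
  have hchar : CharZero K := charZero_of_injective_algebraMap (algebraMap ℚ_[p] K).injective
  have hd : ConvOnDisc fun k => e k * (k : K)⁻¹ := by
    intro r h0 h1
    refine Summable.of_nonneg_of_le (fun k => by positivity) (fun k => ?_) (he.mul_nat h0 h1)
    rw [norm_mul, mul_comm ‖e k‖, mul_assoc]
    exact mul_le_mul_of_nonneg_right (norm_inv_natCast_le p k) (by positivity)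
  have hF : DiscSeries (fun z => ∑' k, e k * (k : K)⁻¹ * (z - a) ^ k) a
      (fun k => e k * (k : K)⁻¹) := by
    refine ⟨hd, fun u hu => ?_⟩
    simp only [add_sub_cancel_left]
    refine (Summable.of_norm ?_).hasSum
    simpa only [norm_mul, norm_pow] using hd ‖u‖ (norm_nonneg u) hu
  refine ⟨_, _, hF, fun u hu => ⟨_, hF.hasDerivAt_tsum hu, ?_⟩⟩
  have hterm : ∀ k, e (k + 1) * u ^ k =
      e (k + 1) * ((k + 1 : ℕ) : K)⁻¹ * (u ^ (k + 1 - 1) * ((k + 1 : ℕ) : K)) := by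
    intro k
    have : ((k + 1 : ℕ) : K) ≠ 0 := Nat.cast_ne_zero.2 (Nat.succ_ne_zero k)
    rw [Nat.add_sub_cancel]; field_simp
  have hs : Summable fun k => e (k + 1) * u ^ k := by
    rcases eq_or_ne u 0 with rfl | hu0
    · refine summable_of_ne_finset_zero (s := {0}) fun k hk => ?_
      have : k ≠ 0 := by simpa using hk
      simp [this]
    · have h1 : Summable fun k => e k * u ^ k := by
        refine Summable.of_norm ?_
        simpa only [norm_mul, norm_pow] using he ‖u‖ (norm_nonneg u) hu
      have h2 := ((summable_nat_add_iff 1).2 h1).mul_right u⁻¹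
      refine h2.congr fun k => ?_
      rw [pow_succ]; field_simp
  simp_rw [hterm] at hs ⊢
  have h3 : Summable fun k : ℕ => e k * (k : K)⁻¹ * (u ^ (k - 1) * (k : K)) :=
    (summable_nat_add_iff 1).1 hs
  rw [h3.tsum_eq_zero_add]
  simp only [he0, zero_mul, zero_add]
  exact hs.hasSum

theorem convOnDisc_recursion {a : K} (ha : ‖a‖ = 1) {c e : ℕ → K} (hc : ConvOnDisc c)
    (he0 : e 0 = 0) (he : ∀ k, e (k + 1) = (c k - e k) / a) : ConvOnDisc e := by
  have hb : ∀ k, ‖e k‖ ≤ ∑ j ∈ Finset.range k, ‖c j‖ := by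
    intro k
    induction k with
    | zero => simp [he0]
    | succ k ih =>
      rw [he, norm_div, ha, div_one, Finset.sum_range_succ]
      exact (norm_sub_le _ _).trans (by linarith)
  intro r h0 h1
  obtain ⟨s, hrs, hs1⟩ := exists_between h1
  have hs0 : 0 < s := lt_of_le_of_lt h0 hrs
  have hB := hc s hs0.le hs1
  refine Summable.of_nonneg_of_le (fun k => by positivity) (fun k => ?_)
    ((summable_geometric_of_lt_one (div_nonneg h0 hs0.le) ((div_lt_one hs0).2 hrs)).mul_left
      (∑' j, ‖c j‖ * s ^ j))
  have h2 : ‖e k‖ * s ^ k ≤ ∑' j, ‖c j‖ * s ^ j := by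
    refine (mul_le_mul_of_nonneg_right (hb k) (by positivity)).trans ?_
    rw [Finset.sum_mul]
    refine le_trans (Finset.sum_le_sum fun j hj => ?_)
      (hB.sum_le_tsum (Finset.range k) fun j _ => by positivity)
    refine mul_le_mul_of_nonneg_left ?_ (norm_nonneg _)
    exact pow_le_pow_of_le_one hs0.le hs1.le (Finset.mem_range.1 hj).le
  have h3 : ‖e k‖ * r ^ k = (‖e k‖ * s ^ k) * (r / s) ^ k := by
    rw [div_pow]; field_simp
  rw [h3]
  exact mul_le_mul_of_nonneg_right h2 (by have := div_nonneg h0 hs0.le; positivity)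

theorem exists_primitive (p : ℕ) [Fact p.Prime] {K : Type*} [NontriviallyNormedField K]
    [NormedAlgebra ℚ_[p] K] [IsUltrametricDist K] [CompleteSpace K] 
    {L : K → K} (hL : ∀ a ∈ affinoid K, ∃ c, DiscSeries L a c)
    (hL0 : L 0 = 0) {a : K} (ha : a ∈ affinoid K) :
    ∃ F : K → K, F 0 = 0 ∧ (∃ d, DiscSeries F a d) ∧
      ∀ z, ‖z - a‖ < 1 → z ≠ 0 → HasDerivAt F (L z / z) z := by
  suffices h : ∃ F : K → K, (∃ d, DiscSeries F a d) ∧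
      ∀ z, ‖z - a‖ < 1 → z ≠ 0 → HasDerivAt F (L z / z) z by
    obtain ⟨F, ⟨d, hd⟩, hF⟩ := h
    refine ⟨fun z => F z + -F 0, by simp, ⟨_, hd.add (DiscSeries.const a (-F 0))⟩, fun z hz hz0 => ?_⟩
    exact (hF z hz hz0).add_const _
  rcases lt_or_eq_of_le ha.1 with ha1 | ha1
  · have h0mem : (0 : K) ∈ affinoid K := by simp [affinoid]
    obtain ⟨c, hc⟩ := hL 0 h0mem
    have hc0 : c 0 = 0 := by
      have h := (hc.2 0 (by simp)).unique (hasSum_single 0 fun k hk => by simp [hk])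
      simpa [hL0] using h.symm
    obtain ⟨F, d, hF, hD⟩ := exists_primitive_aux p 0 hc0 hc.1
    refine ⟨F, ⟨_, hF.recenter (a := a) (by simpa using ha1)⟩, fun z hz hz0 => ?_⟩
    have hz1 : ‖z‖ < 1 := by
      have : z = (z - a) + a := by ring
      rw [this]; exact lt_of_le_of_lt (IsUltrametricDist.norm_add_le_max _ _) (max_lt hz ha1)
    obtain ⟨D, hFD, hs⟩ := hD z hz1
    rw [zero_add] at hFD
    have h1 : HasSum (fun k => c (k + 1) * z ^ (k + 1)) (z * D) := by
      refine (hs.mul_left z).congr_fun ?_ |> id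
      intro k; rw [pow_succ]; ring
    have h2 := (hasSum_nat_add_iff' 1).2 (hc.2 z hz1)
    simp only [Finset.range_one, Finset.sum_singleton, hc0, zero_mul, sub_zero, zero_add] at h2
    rw [← h1.unique h2, mul_div_cancel_left₀ _ hz0]
    exact hFD
  · obtain ⟨c, hc⟩ := hL a ha
    have ha0 : a ≠ 0 := by rw [← norm_ne_zero_iff, ha1]; simp
    let e : ℕ → K := fun k => Nat.rec 0 (fun k x => (c k - x) / a) k
    have he0 : e 0 = 0 := rfl
    have he : ∀ k, e (k + 1) = (c k - e k) / a := fun k => rfl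
    have hconv := convOnDisc_recursion ha1 hc.1 he0 he
    obtain ⟨F, d, hF, hD⟩ := exists_primitive_aux p a he0 hconv
    refine ⟨F, ⟨d, hF⟩, fun z hz hz0 => ?_⟩
    obtain ⟨u, rfl⟩ : ∃ u, z = a + u := ⟨z - a, by ring⟩
    have hu : ‖u‖ < 1 := by simpa using hz
    obtain ⟨D, hFD, hs⟩ := hD u hu
    have h1 : HasSum (fun k => e (k + 1) * u ^ (k + 1)) (u * D) := by
      refine (hs.mul_left u).congr_fun ?_ |> id
      intro k; rw [pow_succ]; ring
    have h2 : HasSum (fun k => e k * u ^ k) (u * D) := by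
      refine (hasSum_nat_add_iff' 1).1 ?_
      simpa [he0] using h1
    have h3 := (hs.mul_left a).add h2
    have h4 : HasSum (fun k => c k * u ^ k) (a * D + u * D) := by
      refine h3.congr_fun ?_ |> id
      intro k
      rw [he]; field_simp; ring
    rw [← h4.unique (hc.2 u hu), ← add_mul, mul_div_cancel_left₀ _ hz0]
    exact hFD

/-- The properties carried along the inductive construction. -/
def GoodStep (p : ℕ) {K : Type*} [NontriviallyNormedField K] (n : ℕ) (L : K → K) : Prop :=
  (∀ a ∈ affinoid K, ∃ c, DiscSeries L a c) ∧ L 0 = 0 ∧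
    ∀ z ∈ affinoid K, L z - L (z ^ p) / (p : K) ^ n = riemannLimit p n z

theorem goodStep_zero : GoodStep p 0 (fun z : K => z / (1 - z)) := by
  refine ⟨fun a ha => ?_, by simp, fun z hz => ?_⟩
  · obtain ⟨c, -, hc⟩ := discSeries_combo (p := p) (K := K) (ψ := fun i => if i = 1 then 1 else 0)
      (ε := 1) zero_le_one (M := 2) (fun i _ => by split_ifs <;> simp) 0 ha
    refine ⟨c, hc.congr fun z _ => ?_⟩
    simp [combo]
  · rw [riemannLimit_zero_left hz]; simp

/-- The periods of the residue disc of `z` under the Frobenius `z ↦ z ^ p`. -/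
def period (p : ℕ) {K : Type*} [NormedField K] (z : K) : ℕ :=
  sInf {f : ℕ | 0 < f ∧ ‖z ^ p ^ f - z‖ < 1}

theorem norm_sub_lt_trans {x y z : K} (h1 : ‖x - y‖ < 1) (h2 : ‖y - z‖ < 1) : ‖x - z‖ < 1 := by
  have : x - z = (x - y) + (y - z) := by ring
  rw [this]; exact lt_of_le_of_lt (IsUltrametricDist.norm_add_le_max _ _) (max_lt h1 h2)

theorem norm_pow_sub_lt {a z : K} (ha : a ∈ affinoid K) (h : ‖z - a‖ < 1) (n : ℕ) :
    ‖z ^ n - a ^ n‖ < 1 :=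
  lt_of_le_of_lt (norm_pow_sub_pow_le (mem_affinoid_of_close ha h).1 ha.1 n) h

theorem period_eq_of_close {a z : K} (ha : a ∈ affinoid K) (h : ‖z - a‖ < 1) :
    period p z = period p a := by
  unfold period
  congr 1
  ext f
  have h' : ‖a - z‖ < 1 := by rwa [norm_sub_rev]
  have h2 := norm_pow_sub_lt ha h (p ^ f)
  have h2' : ‖a ^ p ^ f - z ^ p ^ f‖ < 1 := by rwa [norm_sub_rev]
  refine and_congr_right fun _ => ⟨fun h3 => ?_, fun h3 => ?_⟩
  · exact norm_sub_lt_trans (norm_sub_lt_trans h2' h3) h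
  · exact norm_sub_lt_trans (norm_sub_lt_trans h2 h3) h'

theorem period_pow {z : K} (hz : z ∈ affinoid K) : period p (z ^ p) = period p z := by
  unfold period
  congr 1
  ext f
  refine and_congr_right fun _ => ?_
  rw [← pow_mul, mul_comm, pow_mul]
  exact norm_pow_p_sub_lt_iff p (pow_pow_mem_affinoid p hz f).1 hz.1

theorem goodStep_succ (hper : ∀ z ∈ affinoid K, ∃ f, 0 < f ∧ ‖z ^ p ^ f - z‖ < 1)
    {n : ℕ} {L : K → K} (hL : GoodStep p n L) :
    ∃ L' : K → K, GoodStep p (n + 1) L' ∧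
      ∀ z ∈ affinoid K, z ≠ 0 → HasDerivAt L' (L z / z) z := by
  classical
  have hp : p.Prime := Fact.out
  have hchar : CharZero K := charZero_of_injective_algebraMap (algebraMap ℚ_[p] K).injective
  have hpK : (p : K) ≠ 0 := by exact_mod_cast hp.ne_zero
  obtain ⟨hLan, hL0, hLfrob⟩ := hL
  have hprim : ∀ b : K, ∃ F : K → K, b ∈ affinoid K → F 0 = 0 ∧ (∃ d, DiscSeries F b d) ∧
      ∀ z, ‖z - b‖ < 1 → z ≠ 0 → HasDerivAt F (L z / z) z := by
    intro b
    by_cases hb : b ∈ affinoid K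
    · obtain ⟨F, hF⟩ := exists_primitive p hLan hL0 hb
      exact ⟨F, fun _ => hF⟩
    · exact ⟨0, fun h => absurd h hb⟩
  choose P hP using hprim
  let rep : K → K := fun z => Classical.epsilon fun b => ‖z - b‖ < 1
  have hrep : ∀ z : K, ‖z - rep z‖ < 1 := fun z =>
    Classical.epsilon_spec (p := fun b => ‖z - b‖ < 1) ⟨z, by simp⟩
  have hrep' : ∀ z : K, ‖rep z - z‖ < 1 := fun z => by rw [norm_sub_rev]; exact hrep z
  have hrepeq : ∀ a z : K, ‖z - a‖ < 1 → rep z = rep a := by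
    intro a z h
    have h' : ‖a - z‖ < 1 := by rwa [norm_sub_rev]
    have : (fun b => ‖z - b‖ < 1) = fun b => ‖a - b‖ < 1 := by
      funext b
      exact propext ⟨fun h3 => norm_sub_lt_trans h' h3, fun h3 => norm_sub_lt_trans h h3⟩
    simp only [rep, this]
  have hrepmem : ∀ a ∈ affinoid K, rep a ∈ affinoid K := fun a ha =>
    mem_affinoid_of_close ha (hrep' a)
  let M : K → K := fun z => P (rep z) z
  have hMP : ∀ a z : K, ‖z - a‖ < 1 → M z = P (rep a) z := fun a z h => by
    simp only [M, hrepeq a z h]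
  have hM0 : M 0 = 0 := (hP _ (hrepmem 0 (by simp [affinoid]))).1
  have hMan : ∀ a ∈ affinoid K, ∃ d, DiscSeries M a d := by
    intro a ha
    obtain ⟨-, ⟨d, hd⟩, -⟩ := hP _ (hrepmem a ha)
    exact ⟨_, (hd.recenter (hrep a)).congr fun z hz => (hMP a z hz).symm⟩
  have hnear : ∀ a : K, ∀ᶠ z in 𝓝 a, ‖z - a‖ < 1 := fun a => by
    filter_upwards [Metric.ball_mem_nhds a one_pos] with z hz
    simpa [dist_eq_norm] using hz
  have hMd : ∀ a ∈ affinoid K, a ≠ 0 → HasDerivAt M (L a / a) a := by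
    intro a ha ha0
    obtain ⟨-, -, hd⟩ := hP _ (hrepmem a ha)
    refine (hd a (hrep a) ha0).congr_of_eventuallyEq ?_
    filter_upwards [hnear a] with z hz
    exact hMP a z hz
  set t : K := ((p : K) ^ (n + 1))⁻¹ with ht
  let h : K → K := fun z => M z + (-t) * M (z ^ p) + (-1) * riemannLimit p (n + 1) z
  have hh0 : h 0 = 0 := by
    simp [h, hM0, riemannLimit_zero_right, hp.ne_zero]
  have hhan : ∀ a ∈ affinoid K, ∃ d, DiscSeries h a d := by
    intro a ha
    obtain ⟨d1, h1⟩ := hMan a ha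
    obtain ⟨d2, h2⟩ := hMan (a ^ p) (pow_mem_affinoid p ha)
    obtain ⟨d3, h3⟩ := discSeries_riemannLimit (p := p) (n + 1) ha
    have h4 := h2.comp (a := a)
      ((Polynomial.X + Polynomial.C a) ^ p - Polynomial.C (a ^ p)) ?_ ?_
    · have h5 : DiscSeries (fun z => M (z ^ p)) a _ := h4.congr fun z _ => by simp
      exact ⟨_, (h1.add (h5.smul (-t))).add (h3.smul (-1))⟩
    · simp [Polynomial.coeff_zero_eq_eval_zero]
      
    · intro i
      rw [Polynomial.coeff_sub]
      refine (norm_sub_le_max' _ _).trans (max_le (norm_coeff_X_add_C_pow_le ha.1 _ _) ?_)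
      rw [Polynomial.coeff_C]
      split_ifs
      · rw [norm_pow]; exact pow_le_one₀ (norm_nonneg _) ha.1
      · simp
  have hhd : ∀ a ∈ affinoid K, a ≠ 0 → HasDerivAt h 0 a := by
    intro a ha ha0
    have d1 := hMd a ha ha0
    have d2 := (hMd (a ^ p) (pow_mem_affinoid p ha) (pow_ne_zero _ ha0)).comp a (hasDerivAt_pow p a)
    have d3 := hasDerivAt_riemannLimit (p := p) n ha ha0
    have d4 := (d1.fun_add (d2.const_mul (-t))).fun_add (d3.const_mul (-1))
    have e : L a / a + -t * (L (a ^ p) / a ^ p * ((p : K) * a ^ (p - 1))) +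
        -1 * (riemannLimit p n a / a) = 0 := by
      rw [← hLfrob a ha]
      obtain ⟨q, hq⟩ : ∃ q, p = q + 1 := ⟨p - 1, (Nat.succ_pred_prime hp).symm⟩
      have hap : a ^ p = a * a ^ (p - 1) := by
        conv_lhs => rw [hq]
        rw [hq, Nat.add_sub_cancel, pow_succ']
      generalize L (a ^ p) = y
      rw [hap, ht, pow_succ]
      field_simp
      ring
    rw [e] at d4
    exact d4
  have hconst1 : ∀ a ∈ affinoid K, a ≠ 0 → ∀ z, ‖z - a‖ < 1 → h z = h a := by
    intro a ha ha0
    obtain ⟨d, hd⟩ := hhan a ha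
    refine hd.eq_const ?_
    filter_upwards [hnear a, eventually_ne_nhds ha0] with z hz hz0
    exact hhd z (mem_affinoid_of_close ha hz) hz0
  have hconst : ∀ a ∈ affinoid K, ∀ z, ‖z - a‖ < 1 → h z = h a := by
    intro a ha z hz
    rcases eq_or_ne a 0 with rfl | ha0
    · have hpn : ‖(p : K)‖ < 1 := by
        have := norm_p_pow (p := p) (K := K) 1
        rw [pow_one, pow_one] at this
        rw [this]; exact inv_p_lt_one
      have hpm : (p : K) ∈ affinoid K := mem_affinoid_of_close ha (by simpa using hpn)
      have hp0 : ‖(0 : K) - (p : K)‖ < 1 := by simpa using hpn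
      rw [hconst1 _ hpm hpK z (norm_sub_lt_trans hz hp0), hconst1 _ hpm hpK 0 hp0]
    · exact hconst1 a ha ha0 z hz
  let κ : K → K := fun z =>
    (∑ i ∈ Finset.range (period p z), t ^ i * h (z ^ p ^ i)) / (1 - t ^ period p z)
  have hκconst : ∀ a ∈ affinoid K, ∀ z, ‖z - a‖ < 1 → κ z = κ a := by
    intro a ha z hz
    simp only [κ, period_eq_of_close (p := p) ha hz]
    congr 1
    refine Finset.sum_congr rfl fun i _ => ?_
    rw [hconst _ (pow_pow_mem_affinoid p ha i) _ (norm_pow_sub_lt ha hz _)]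
  have hκ0 : κ 0 = 0 := by
    simp only [κ]
    rw [Finset.sum_eq_zero, zero_div]
    intro i _
    rw [zero_pow (pow_ne_zero _ hp.ne_zero), hh0, mul_zero]
  have hκ : ∀ z ∈ affinoid K, κ z - t * κ (z ^ p) = h z := by
    intro z hz
    have hN : 0 < period p z ∧ ‖z ^ p ^ period p z - z‖ < 1 := Nat.sInf_mem (hper z hz)
    have htN : (1 : K) - t ^ period p z ≠ 0 := by
      intro h1
      have h2 : ‖t ^ period p z‖ = 1 := by rw [← sub_eq_zero.1 h1]; simp
      have h3 : ‖t‖ = ((p : ℝ) ^ (n + 1)) := by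
        have := norm_p_pow (p := p) (K := K) (n + 1)
        push_cast at this
        rw [ht, norm_inv, this, inv_pow, inv_inv]
      rw [norm_pow, h3] at h2
      have h4 : (1 : ℝ) < (p : ℝ) ^ (n + 1) :=
        one_lt_pow₀ (by exact_mod_cast hp.one_lt) (Nat.succ_ne_zero n)
      exact (one_lt_pow₀ h4 hN.1.ne').ne' h2
    have hlast : h (z ^ p ^ period p z) = h z := hconst z hz _ hN.2
    simp only [κ, period_pow (p := p) hz]
    have hshift : t * ∑ i ∈ Finset.range (period p z), t ^ i * h ((z ^ p) ^ p ^ i) =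
        ∑ i ∈ Finset.range (period p z), t ^ (i + 1) * h (z ^ p ^ (i + 1)) := by
      rw [Finset.mul_sum]
      refine Finset.sum_congr rfl fun i _ => ?_
      rw [← pow_mul, ← pow_succ', pow_succ' t]; ring
    have htel := Finset.sum_range_sub (fun i => t ^ i * h (z ^ p ^ i)) (period p z)
    rw [Finset.sum_sub_distrib, ← hshift, hlast] at htel
    simp only [pow_zero, one_mul, pow_one] at htel
    rw [mul_div_assoc', ← sub_div, div_eq_iff htN]
    linear_combination -htel
  refine ⟨fun z => M z + -κ z, ⟨fun a ha => ?_, by simp [hM0, hκ0], fun z hz => ?_⟩,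
    fun z hz hz0 => ?_⟩
  · obtain ⟨d, hd⟩ := hMan a ha
    exact ⟨_, (hd.add (DiscSeries.const a (-κ a))).congr fun z hz => by rw [hκconst a ha z hz]⟩
  · have h1 := hκ z hz
    simp only [h] at h1
    rw [div_eq_mul_inv, ← ht]
    linear_combination -h1
  · refine ((hMd z hz hz0).add_const (-κ z)).congr_of_eventuallyEq ?_
    filter_upwards [hnear z] with y hy
    rw [hκconst z hz y hy]

theorem exists_family (hper : ∀ z ∈ affinoid K, ∃ f, 0 < f ∧ ‖z ^ p ^ f - z‖ < 1) :
    ∃ Li : ℕ → K → K, (Li 0 = fun z => z / (1 - z)) ∧ ∀ n, GoodStep p n (Li n) ∧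
      ∀ z ∈ affinoid K, z ≠ 0 → HasDerivAt (Li (n + 1)) (Li n z / z) z := by
  choose next hnext hnext' using fun (n : ℕ) (L : {L : K → K // GoodStep p n L}) =>
    goodStep_succ hper L.2
  let fam : ∀ n, {L : K → K // GoodStep p n L} := fun n =>
    Nat.rec ⟨fun z => z / (1 - z), goodStep_zero⟩ (fun n L => ⟨next n L, hnext n L⟩) n
  exact ⟨fun n => (fam n).1, rfl, fun n => ⟨(fam n).2, hnext' n (fam n)⟩⟩

end Existence

section Periodicity

variable {p : ℕ} [Fact p.Prime]

theorem norm_eval_int_le {K : Type*} [NormedField K] [IsUltrametricDist K] {z : K} (hz : ‖z‖ ≤ 1)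
    (f : Polynomial ℤ) : ‖Polynomial.eval₂ (Int.castRingHom _) z f‖ ≤ 1 := by
  rw [Polynomial.eval₂_eq_sum_range]
  refine IsUltrametricDist.norm_sum_le_of_forall_le_of_nonneg zero_le_one fun i _ => ?_
  rw [norm_mul, norm_pow]
  exact mul_le_one₀ (IsUltrametricDist.norm_intCast_le_one K _) (by positivity)
    (pow_le_one₀ (norm_nonneg _) hz)

theorem exists_monic_int (z : ℂ_[p]) (hz : ‖z‖ ≤ 1) :
    ∃ f : Polynomial ℤ, f.Monic ∧ ‖Polynomial.eval₂ (Int.castRingHom _) z f‖ < 1 := by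
  obtain ⟨y, hy⟩ : ∃ y : PadicAlgCl p, ‖z - (y : ℂ_[p])‖ < 1 := by
    obtain ⟨y, hy⟩ := (UniformSpace.Completion.denseRange_coe (α := PadicAlgCl p)).exists_dist_lt z
      one_pos
    exact ⟨y, by rwa [dist_eq_norm] at hy⟩
  have hy1 : ‖(y : ℂ_[p])‖ ≤ 1 := by
    have : (y : ℂ_[p]) = z - (z - y) := by ring
    rw [this]; exact (norm_sub_le_max' _ _).trans (max_le hz hy.le)
  have hy2 : ‖y‖ ≤ 1 := by rwa [PadicComplex.norm_extends] at hy1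
  have hint : IsIntegral ℚ_[p] y := Algebra.IsIntegral.isIntegral y
  set μ := minpoly ℚ_[p] y with hμ
  have hmon : μ.Monic := minpoly.monic hint
  have hcoef : ∀ i, ‖μ.coeff i‖ ≤ 1 := by
    have h1 : spectralValue μ ≤ 1 := by
      have : spectralNorm ℚ_[p] (PadicAlgCl p) y = ‖y‖ := PadicAlgCl.spectralNorm_eq p y
      rw [← this] at hy2
      exact hy2
    exact (spectralValue_le_one_iff hmon).1 h1
  have happ : ∀ i, ∃ k : ℕ, ‖μ.coeff i - (k : ℚ_[p])‖ < 1 := by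
    intro i
    obtain ⟨x, hx⟩ : ∃ x : ℤ_[p], (x : ℚ_[p]) = μ.coeff i := ⟨⟨μ.coeff i, hcoef i⟩, rfl⟩
    obtain ⟨k, -, hk⟩ := PadicInt.exists_mem_range (p := p) x
    refine ⟨k, ?_⟩
    have := (PadicInt.mem_nonunits).1 ((IsLocalRing.mem_maximalIdeal _).1 hk)
    rw [PadicInt.norm_def, PadicInt.coe_sub, PadicInt.coe_natCast, hx] at this
    exact this
  choose k hk using happ
  set d := μ.natDegree with hd
  set f : Polynomial ℤ := Polynomial.X ^ d +
    ∑ i ∈ Finset.range d, Polynomial.C ((k i : ℕ) : ℤ) * Polynomial.X ^ i with hf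
  have hfm : f.Monic := by
    refine Polynomial.monic_X_pow_add ?_
    refine (Polynomial.degree_sum_le _ _).trans_lt ?_
    rw [Finset.sup_lt_iff (by simp [bot_lt_iff_ne_bot])]
    intro i hi
    exact (Polynomial.degree_C_mul_X_pow_le _ _).trans_lt (by exact_mod_cast Finset.mem_range.1 hi)
  refine ⟨f, hfm, ?_⟩
  have h1 : ‖Polynomial.eval₂ (Int.castRingHom _) z f - Polynomial.eval₂ (Int.castRingHom _) (y : ℂ_[p]) f‖ < 1 := by
    rw [Polynomial.eval₂_eq_sum_range, Polynomial.eval₂_eq_sum_range, ← Finset.sum_sub_distrib]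
    refine lt_of_le_of_lt (IsUltrametricDist.norm_sum_le_of_forall_le_of_nonneg (norm_nonneg _)
      fun i _ => ?_) hy
    rw [← mul_sub, norm_mul]
    exact (mul_le_of_le_one_left (norm_nonneg _) (IsUltrametricDist.norm_intCast_le_one _ _)).trans
      (norm_pow_sub_pow_le hz hy1 i)
  have h2 : ‖Polynomial.eval₂ (Int.castRingHom _) (y : ℂ_[p]) f‖ < 1 := by
    have e1 : Polynomial.eval₂ (Int.castRingHom _) (y : ℂ_[p]) f = ((Polynomial.eval₂ (Int.castRingHom _) y f : PadicAlgCl p) : ℂ_[p]) := by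
      rw [PadicComplex.coe_eq, PadicComplex.coe_eq, Polynomial.hom_eval₂]
      congr 1
      exact RingHom.ext_int _ _
    rw [e1, PadicComplex.norm_extends]
    have e2 : Polynomial.eval₂ (Int.castRingHom _) y f = ∑ i ∈ Finset.range d,
        algebraMap ℚ_[p] (PadicAlgCl p) ((k i : ℚ_[p]) - μ.coeff i) * y ^ i := by
      have h0 : Polynomial.aeval y μ = 0 := minpoly.aeval _ _
      rw [Polynomial.aeval_eq_sum_range, Finset.sum_range_succ, ← hd, hd, hmon.coeff_natDegree,
        one_smul, ← hd] at h0
      simp only [hf, Polynomial.eval₂_add, Polynomial.eval₂_finsetSum, Polynomial.eval₂_mul,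
        Polynomial.eval₂_pow, Polynomial.eval₂_X, map_sub, sub_mul,
        Finset.sum_sub_distrib, map_natCast, Polynomial.eval₂_natCast]
      rw [eq_neg_of_add_eq_zero_right h0]
      simp only [Algebra.smul_def]
      ring
    rw [e2]
    obtain hd0 | hd0 := Nat.eq_zero_or_pos d
    · simp [hd0]
    obtain ⟨i, hi, hle⟩ := IsUltrametricDist.exists_norm_finsetSum_le_of_nonempty
      (Finset.nonempty_range_iff.2 hd0.ne') (fun i =>
        algebraMap ℚ_[p] (PadicAlgCl p) ((k i : ℚ_[p]) - μ.coeff i) * y ^ i)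
    refine lt_of_le_of_lt hle ?_
    rw [norm_mul, norm_pow, norm_algebraMap', norm_sub_rev]
    exact lt_of_le_of_lt (mul_le_of_le_one_right (norm_nonneg _)
      (pow_le_one₀ (norm_nonneg _) hy2)) (hk i)
  have : Polynomial.eval₂ (Int.castRingHom _) z f = (Polynomial.eval₂ (Int.castRingHom _) z f - Polynomial.eval₂ (Int.castRingHom _) (y : ℂ_[p]) f) +
    Polynomial.eval₂ (Int.castRingHom _) (y : ℂ_[p]) f := by ring
  rw [this]
  exact lt_of_le_of_lt (IsUltrametricDist.norm_add_le_max _ _) (max_lt h1 h2)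

theorem exists_period (z : ℂ_[p]) (hz : ‖z‖ ≤ 1) : ∃ f, 0 < f ∧ ‖z ^ p ^ f - z‖ < 1 := by
  obtain ⟨f, hf, hfz⟩ := exists_monic_int z hz
  have hpn : ‖(p : ℂ_[p])‖ < 1 := by
    have := norm_p_pow (p := p) (K := ℂ_[p]) 1
    rw [pow_one, pow_one] at this
    rw [this]; exact inv_p_lt_one
  let r : ℕ → Polynomial ℤ := fun i => Polynomial.X ^ p ^ i %ₘ f
  have hr : ∀ i, ‖z ^ p ^ i - Polynomial.eval₂ (Int.castRingHom _) z (r i)‖ < 1 := by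
    intro i
    have h := Polynomial.modByMonic_add_div (Polynomial.X ^ p ^ i) f
    have h' := congrArg (Polynomial.eval₂ (Int.castRingHom _) z) h
    rw [Polynomial.eval₂_add, Polynomial.eval₂_mul, Polynomial.eval₂_pow, Polynomial.eval₂_X] at h'
    rw [← h', add_sub_cancel_left, norm_mul]
    exact lt_of_le_of_lt (mul_le_of_le_one_right (norm_nonneg _) (norm_eval_int_le hz _)) hfz
  obtain ⟨i, j, hij, he⟩ := Finite.exists_ne_map_eq_of_infinite
    (fun i : ℕ => fun l : Fin (f.natDegree + 1) => (((r i).coeff l : ℤ) : ZMod p))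
  have hdeg : ∀ i, (r i).natDegree ≤ f.natDegree := fun i => Polynomial.natDegree_modByMonic_le _ hf
  have hsub : ‖Polynomial.eval₂ (Int.castRingHom _) z (r i) - Polynomial.eval₂ (Int.castRingHom _) z (r j)‖ < 1 := by
    have hdvd : ∀ l, (p : ℤ) ∣ (r i - r j).coeff l := by
      intro l
      rw [Polynomial.coeff_sub]
      by_cases hl : l < f.natDegree + 1
      · have := congrFun he ⟨l, hl⟩
        simp only at this
        exact (ZMod.intCast_eq_intCast_iff_dvd_sub _ _ _).1 this.symm
      · rw [Polynomial.coeff_eq_zero_of_natDegree_lt, Polynomial.coeff_eq_zero_of_natDegree_lt]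
        · simp
        · have := hdeg j; omega
        · have := hdeg i; omega
    rw [← Polynomial.eval₂_sub, Polynomial.eval₂_eq_sum_range]
    refine lt_of_le_of_lt (IsUltrametricDist.norm_sum_le_of_forall_le_of_nonneg
      (norm_nonneg (p : ℂ_[p])) fun l _ => ?_) hpn
    obtain ⟨m, hm⟩ := hdvd l
    rw [hm, map_mul, map_natCast, mul_assoc, norm_mul]
    refine mul_le_of_le_one_right (norm_nonneg _) ?_
    rw [norm_mul, norm_pow]
    exact mul_le_one₀ (IsUltrametricDist.norm_intCast_le_one _ _) (by positivity)
      (pow_le_one₀ (norm_nonneg _) hz)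
  have hfin : ∀ i j : ℕ, i < j → ‖z ^ p ^ j - z ^ p ^ i‖ < 1 →
      ∃ f, 0 < f ∧ ‖z ^ p ^ f - z‖ < 1 := by
    intro i
    induction i with
    | zero => intro j hj h; exact ⟨j, hj, by simpa using h⟩
    | succ i ih =>
      intro j hj h
      obtain ⟨j, rfl⟩ : ∃ j', j = j' + 1 := ⟨j - 1, by omega⟩
      rw [pow_succ, pow_mul, pow_succ p i, pow_mul] at h
      refine ih j (by omega) ((norm_pow_p_sub_lt_iff p ?_ ?_).1 h) <;>
      · rw [norm_pow]; exact pow_le_one₀ (norm_nonneg _) hz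
  have hj' : ‖Polynomial.eval₂ (Int.castRingHom _) z (r j) - z ^ p ^ j‖ < 1 := by rw [norm_sub_rev]; exact hr j
  have hall := norm_sub_lt_trans (norm_sub_lt_trans (hr i) hsub) hj'
  rcases lt_or_gt_of_ne hij with h | h
  · exact hfin i j h (by rw [norm_sub_rev]; exact hall)
  · exact hfin j i h hall

end Periodicity
section Polylog

variable (p : ℕ) [Fact p.Prime]

theorem isRigidAnalytic_riemannLimit (n : ℕ) :
    IsRigidAnalytic (riemannLimit p n : ℂ_[p] → ℂ_[p]) := by
  intro ε hε
  obtain ⟨m, hm⟩ := exists_pow_lt_of_lt_one hε (inv_p_lt_one (p := p))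
  refine ⟨∑ i ∈ Finset.range (p ^ m), Polynomial.C (primeToPow p ℂ_[p] n i) * Polynomial.X ^ i,
    1 - Polynomial.X ^ p ^ m, fun z hz => ⟨?_, ?_⟩⟩
  · have := norm_one_sub_eq (pow_pow_mem_affinoid p hz m)
    rw [← norm_ne_zero_iff]
    simp [this]
  · have := norm_riemannLimit_sub_le (p := p) n m hz
    simp only [riemannSum, combo] at this
    simp only [Polynomial.eval_finsetSum, Polynomial.eval_mul, Polynomial.eval_C,
      Polynomial.eval_pow, Polynomial.eval_X, Polynomial.eval_sub, Polynomial.eval_one]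
    exact this.trans hm.le

theorem exists_isColemanPolylog : ∃ Li : ℕ → ℂ_[p] → ℂ_[p], IsColemanPolylog p Li := by
  obtain ⟨Li, h0, h⟩ := exists_family (p := p) (K := ℂ_[p]) fun z hz => exists_period z hz.1
  refine ⟨Li, fun z _ => by rw [h0], fun n a ha => ?_, fun n => (h n).2, fun n => (h n).1.2.1,
    fun n ε hε => ?_⟩
  · obtain ⟨c, hc⟩ := (h n).1.1 a ha
    exact ⟨_, hc.hasFPowerSeriesOnBall⟩
  · obtain ⟨P, Q, hPQ⟩ := isRigidAnalytic_riemannLimit p n ε hε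
    refine ⟨P, Q, fun z hz => ⟨(hPQ z hz).1, ?_⟩⟩
    have hG := (h n).1.2.2 z hz
    simp only [hG]
    exact (hPQ z hz).2

/-! The objects of the theorem. -/

/-- The `p`-adic polylogarithm `Li n`. It is meaningful for `z` in the affinoid, where
`IsColemanPolylog` determines it. -/
def polylog : ℕ → ℂ_[p] → ℂ_[p] := Classical.choose (exists_isColemanPolylog p)

theorem isColemanPolylog_polylog : IsColemanPolylog p (polylog p) :=
  Classical.choose_spec (exists_isColemanPolylog p)

/-- The normalized polylogarithm `p ^ (-n) * Li n`. -/
def normalizedPolylog (n : ℕ) (z : ℂ_[p]) : ℂ_[p] := polylog p n z / (p : ℂ_[p]) ^ n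

/-- The ring `W` of Witt vectors of an algebraic closure of `𝔽_p`, as a subring of `ℂ_[p]`: the
ring of integers of the completed maximal unramified extension of `ℚ_p`, which is the closure of the
subring generated by the roots of unity of order prime to `p`. -/
def wittRing : Subring ℂ_[p] :=
  (Subring.closure {ζ : ℂ_[p] | ∃ m : ℕ, p.Coprime m ∧ ζ ^ m = 1}).topologicalClosure

/-- The set `X` of all `z ∈ W` with `|z| = |z - 1| = 1`. -/
def unitSet : Set ℂ_[p] := {z | z ∈ wittRing p ∧ ‖z‖ = 1 ∧ ‖z - 1‖ = 1}

/-- Congruence of elements of `W` modulo `p`: both sides lie in `W`, the difference lies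
in `p W`. -/
def CongrModP (x y : ℂ_[p]) : Prop :=
  x ∈ wittRing p ∧ y ∈ wittRing p ∧ ∃ c ∈ wittRing p, x - y = (p : ℂ_[p]) * c

end Polylog

end ColemanPolylog
end

/-! Write `z = α(1 + x)`, and let `A n k` be the Taylor coefficients of `Li n` in `x`. The equation
`d Li (n+1) = Li n * dz/z` becomes `(1 + x) d/dx Li (n+1) = Li n`, that is, `(k+1) A (n+1) (k+1) + k
A (n+1) k = A n k` (`DiscSeries.coeff_recursion`, `exists_taylor_coeff`). At `x = p w` the relevant
numbers are `B n k = p^k A n k / p^n`, and for them the recursion reads `(k+1) B (n+1) (k+1) = B n k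
- p k B (n+1) k`. Modulo `p` the last term disappears, so `B n k` is congruent to `B (n-k) 0 / k!`
for `k ≤ n` (`coeff_congr_of_le`). These are the coefficients of the asserted sum. For `k > n` the
number `k! A n k` is integral, and since `p > n + 1`, Legendre's bound on the valuation of `k!` puts
`B n k` in `pW` (`coeff_congr_of_lt`). As `W` is closed, the congruence may be summed term by term.

The input is the integrality of `B m 0 = p^(-m) Li m α` (`normalizedPolylog_mem_wittRing`). The
Frobenius transform `Li m z - Li m (z^p) / p^m` takes values in `W` at points of `W` in the
affinoid. For `m > 0` the root of unity `α` is fixed by some `z ↦ z^(p^f)`, because `p` is odd.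
Telescoping along its orbit shows that `p^(mf) - 1`, a unit of `W`, times the normalized value is
integral.

The polylogarithms are known only through Coleman's axioms, which make the transform rigid analytic
but give no formula for it. `IsColemanPolylog.sub_eq_riemannLimit` identifies it with the limit of
Riemann sums, visibly integral: by induction on the level the two agree on the residue disc of `0`,
and the identity principle `IsRigidAnalytic.eq_zero` carries this to the whole affinoid. -/

noncomputable section
namespace ColemanPolylog

/-! ### The identity principle for rigid analytic functions on the affinoid. -/

section RigidIdentity

variable {K : Type*} [NontriviallyNormedField K] [IsUltrametricDist K]

theorem norm_sub_eq_left {x y : K} (h : ‖y‖ < ‖x‖) : ‖x - y‖ = ‖x‖ := by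
  refine le_antisymm ((norm_sub_le_max' x y).trans (max_le le_rfl h.le)) ?_
  by_contra! h1
  have h2 : x = (x - y) + y := by ring
  have h3 := IsUltrametricDist.norm_add_le_max (x - y) y
  rw [← h2] at h3
  exact absurd h3 (not_le.2 (max_lt h1 h))

theorem norm_sub_eq_right {x y : K} (h : ‖x‖ < ‖y‖) : ‖x - y‖ = ‖y‖ := by
  rw [norm_sub_rev]; exact norm_sub_eq_left h

/-- Roots of high order of a fixed nonzero element of norm less than `1` have norms tending to `1`.
Such points approach the boundary of the open disc in the maximum principle below. -/
theorem exists_norm_between {K : Type*} [NontriviallyNormedField K] [IsAlgClosed K] {r : ℝ} (hr : r < 1) : ∃ y : K, r < ‖y‖ ∧ ‖y‖ < 1 := by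
  obtain ⟨x, hx0, hx1⟩ := NormedField.exists_norm_lt_one K
  obtain ⟨s, hrs, hs1⟩ := exists_between (max_lt hr zero_lt_one)
  have hs0 : 0 ≤ s := (le_max_right r 0).trans hrs.le
  obtain ⟨k, hk⟩ := exists_pow_lt_of_lt_one hx0 hs1
  obtain ⟨y, hy⟩ := IsAlgClosed.exists_pow_nat_eq x (Nat.succ_pos k)
  have hy' : ‖y‖ ^ (k + 1) = ‖x‖ := by rw [← norm_pow, hy]
  refine ⟨y, ?_, ?_⟩
  · refine (le_max_left r 0).trans_lt (hrs.trans ?_)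
    refine lt_of_pow_lt_pow_left₀ (k + 1) (norm_nonneg y) ?_
    rw [hy']
    exact (pow_le_pow_of_le_one hs0 hs1.le (Nat.le_succ k)).trans_lt hk
  · rw [← hy'] at hx1
    exact (pow_lt_one_iff_of_nonneg (norm_nonneg _) k.succ_ne_zero).1 hx1

theorem norm_eval_eq_prod_roots [IsAlgClosed K] (P : Polynomial K) (z : K) :
    ‖P.eval z‖ = ‖P.leadingCoeff‖ * (P.roots.map fun s => ‖z - s‖).prod := by
  conv_lhs => rw [(IsAlgClosed.splits P).eq_prod_roots]
  rw [Polynomial.eval_mul, Polynomial.eval_C, norm_mul, Polynomial.eval_multiset_prod,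
    Multiset.map_map]
  congr 1
  induction P.roots using Multiset.induction_on with
  | empty => simp
  | cons a s ih =>
    rw [Multiset.map_cons, Multiset.map_cons, Multiset.prod_cons, Multiset.prod_cons, norm_mul, ih]
    simp

/-- Every linear factor has constant norm on the affinoid. A root `s` outside it has either `‖s‖ >
1`, and then `‖z - s‖ = ‖s‖`, or `‖s - 1‖ < 1`, and then `‖z - s‖ = ‖z - 1‖ = 1`. -/
theorem norm_eval_eq_of_no_roots [IsAlgClosed K] {Q : Polynomial K}
    (hQ : ∀ z ∈ affinoid K, Q.eval z ≠ 0) {z : K} (hz : z ∈ affinoid K) :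
    ‖Q.eval z‖ = ‖Q.eval 0‖ := by
  have h0 : (0 : K) ∈ affinoid K := by simp [affinoid]
  rw [norm_eval_eq_prod_roots, norm_eval_eq_prod_roots]
  congr 2
  refine Multiset.map_congr rfl fun s hs => ?_
  have hs' : s ∉ affinoid K := fun h => hQ s h (Polynomial.isRoot_of_mem_roots hs)
  rw [norm_one_sub_of_mem, not_and, not_not] at hs'
  rcases lt_or_ge 1 ‖s‖ with h | h
  · rw [norm_sub_eq_right (hz.1.trans_lt h), norm_sub_eq_right (by simpa using zero_lt_one.trans h)]
  · have key : ∀ y ∈ affinoid K, ‖y - s‖ = 1 := fun y hy => by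
      have e : y - s = (y - 1) - (s - 1) := by ring
      have h1 : ‖y - 1‖ = 1 := by rw [norm_sub_rev]; exact norm_one_sub_eq hy
      rw [e, norm_sub_eq_left, h1]
      rw [h1]; exact hs' h
    rw [key z hz, key 0 h0]

/-- Compare factor by factor for `y` close to the unit circle. If `‖s‖ < ‖y‖ < 1`, then `‖y - s‖ =
‖y‖` while `‖z - s‖ ≤ 1`; if `‖s‖ ≥ 1`, then `‖y - s‖ = ‖s‖ ≥ ‖z - s‖`. Each root costs at most one
factor `‖y‖`. -/
theorem exists_pow_mul_prod_le (S : Multiset K) : ∃ ρ < 1, ∀ y : K, ρ < ‖y‖ → ‖y‖ < 1 →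
    ∀ z : K, ‖z‖ ≤ 1 →
      ‖y‖ ^ S.card * (S.map fun s => ‖z - s‖).prod ≤ (S.map fun s => ‖y - s‖).prod := by
  induction S using Multiset.induction_on with
  | empty => exact ⟨0, one_pos, by simp⟩
  | cons s S ih =>
    obtain ⟨ρ, hρ, h⟩ := ih
    have hs : ∃ σ < 1, ∀ y : K, σ < ‖y‖ → ‖y‖ < 1 → ∀ z : K, ‖z‖ ≤ 1 →
        ‖y‖ * ‖z - s‖ ≤ ‖y - s‖ := by
      rcases lt_or_ge ‖s‖ 1 with h1 | h1
      · refine ⟨‖s‖, h1, fun y hy _ z hz => ?_⟩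
        rw [norm_sub_eq_left hy]
        exact mul_le_of_le_one_right (norm_nonneg _)
          ((norm_sub_le_max' _ _).trans (max_le hz h1.le))
      · refine ⟨0, one_pos, fun y _ hy1 z hz => ?_⟩
        rw [norm_sub_eq_right (hy1.trans_le h1)]
        exact (mul_le_of_le_one_left (norm_nonneg _) hy1.le).trans
          ((norm_sub_le_max' _ _).trans (max_le (hz.trans h1) le_rfl))
    obtain ⟨σ, hσ, h'⟩ := hs
    refine ⟨max ρ σ, max_lt hρ hσ, fun y hy hy1 z hz => ?_⟩
    rw [max_lt_iff] at hy
    rw [Multiset.map_cons, Multiset.map_cons, Multiset.prod_cons, Multiset.prod_cons,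
      Multiset.card_cons, pow_succ]
    calc _ = (‖y‖ * ‖z - s‖) * (‖y‖ ^ S.card * (S.map fun s => ‖z - s‖).prod) := by ring
      _ ≤ _ := mul_le_mul (h' y hy.2 hy1 z hz) (h y hy.1 hy1 z hz)
        (mul_nonneg (by positivity) (Multiset.prod_nonneg (by simp))) (norm_nonneg _)

/-- A maximum principle: the loss `‖y‖ ^ card` in the comparison of factors tends to `1` as `y`
approaches the unit circle. -/
theorem norm_eval_le_of_open_disc [IsAlgClosed K] {P : Polynomial K} {B : ℝ}
    (hP : ∀ y : K, ‖y‖ < 1 → ‖P.eval y‖ ≤ B) {z : K} (hz : ‖z‖ ≤ 1) : ‖P.eval z‖ ≤ B := by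
  obtain ⟨ρ, hρ, h⟩ := exists_pow_mul_prod_le P.roots
  -- A real number `t` below `‖y‖` replaces `‖y‖`, so that the limit can be taken along real `t →
  -- 1`.
  have key : ∀ t ∈ Set.Ioo (0 : ℝ) 1, t ^ P.roots.card * ‖P.eval z‖ ≤ B := by
    rintro t ⟨ht0, ht1⟩
    obtain ⟨y, hy, hy1⟩ := exists_norm_between (K := K) (max_lt ht1 hρ)
    rw [max_lt_iff] at hy
    refine le_trans ?_ (hP y hy1)
    rw [norm_eval_eq_prod_roots P z, norm_eval_eq_prod_roots P y, mul_left_comm]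
    refine mul_le_mul_of_nonneg_left (le_trans ?_ (h y hy.2 hy1 z hz)) (norm_nonneg _)
    refine mul_le_mul_of_nonneg_right (pow_le_pow_left₀ ht0.le hy.1.le _)
      (Multiset.prod_nonneg fun x hx => ?_)
    obtain ⟨s, -, rfl⟩ := Multiset.mem_map.1 hx
    exact norm_nonneg _
  have hlim : Tendsto (fun t : ℝ => t ^ P.roots.card * ‖P.eval z‖) (𝓝[<] 1) (𝓝 ‖P.eval z‖) := by
    have : Continuous fun t : ℝ => t ^ P.roots.card * ‖P.eval z‖ := by fun_prop
    simpa using (this.tendsto 1).mono_left nhdsWithin_le_nhds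
  refine le_of_tendsto hlim ?_
  filter_upwards [Ioo_mem_nhdsLT (zero_lt_one' ℝ)] with t ht
  exact key t ht

theorem IsRigidAnalytic.sub {f g : K → K} (hf : IsRigidAnalytic f) (hg : IsRigidAnalytic g) :
    IsRigidAnalytic fun z => f z - g z := by
  intro ε hε
  obtain ⟨P, Q, h⟩ := hf ε hε
  obtain ⟨R, S, h'⟩ := hg ε hε
  refine ⟨P * S - R * Q, Q * S, fun z hz => ⟨?_, ?_⟩⟩
  · rw [Polynomial.eval_mul]; exact mul_ne_zero (h z hz).1 (h' z hz).1
  · have e : f z - g z - (P * S - R * Q).eval z / (Q * S).eval z =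
        (f z - P.eval z / Q.eval z) - (g z - R.eval z / S.eval z) := by
      have h1 := (h z hz).1
      have h2 := (h' z hz).1
      simp only [Polynomial.eval_mul, Polynomial.eval_sub]
      field_simp
      ring
    rw [e]
    exact (norm_sub_le_max' _ _).trans (max_le (h z hz).2 (h' z hz).2)

/-- A rigid analytic function on the affinoid that vanishes on the residue disc of `0` vanishes. -/
theorem IsRigidAnalytic.eq_zero [IsAlgClosed K] {f : K → K} (hf : IsRigidAnalytic f)
    (h0 : ∀ z, ‖z‖ < 1 → f z = 0) {z : K} (hz : z ∈ affinoid K) : f z = 0 := by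
  have h0mem : (0 : K) ∈ affinoid K := by simp [affinoid]
  rw [← norm_le_zero_iff]
  refine le_of_forall_pos_le_add fun ε hε => ?_
  rw [zero_add]
  obtain ⟨P, Q, h⟩ := hf ε hε
  have hQ : ∀ z ∈ affinoid K, ‖Q.eval z‖ = ‖Q.eval 0‖ := fun z hz =>
    norm_eval_eq_of_no_roots (fun z hz => (h z hz).1) hz
  have hQ0 : 0 < ‖Q.eval 0‖ := norm_pos_iff.2 (h 0 h0mem).1
  -- On the disc of `0` the quotient `P / Q` is within `ε` of `0`. As `Q` has constant norm, this
  -- bounds the polynomial `P`, to which the maximum principle applies.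
  have hP : ∀ y : K, ‖y‖ < 1 → ‖P.eval y‖ ≤ ε * ‖Q.eval 0‖ := by
    intro y hy
    have hy' : y ∈ affinoid K := mem_affinoid_of_close h0mem (by simpa using hy)
    have := (h y hy').2
    rwa [h0 y hy, zero_sub, norm_neg, norm_div, hQ y hy', div_le_iff₀ hQ0] at this
  have hPz : ‖P.eval z / Q.eval z‖ ≤ ε := by
    rw [norm_div, hQ z hz, div_le_iff₀ hQ0]
    exact norm_eval_le_of_open_disc hP hz.1
  have e : f z = (f z - P.eval z / Q.eval z) + P.eval z / Q.eval z := by ring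
  rw [e]
  exact (IsUltrametricDist.norm_add_le_max _ _).trans (max_le (h z hz).2 hPz)

end RigidIdentity

/-! ### The Frobenius transform, determined from Coleman's axioms. -/

section Uniqueness

theorem discSeries_of_hasFPowerSeriesOnBall {K : Type*} [NontriviallyNormedField K] {f : K → K}
    {a : K} {c : FormalMultilinearSeries K K K} (h : HasFPowerSeriesOnBall f c a 1) :
    DiscSeries f a c.coeff := by
  refine ⟨fun r h0 h1 => ?_, fun u hu => ?_⟩
  · lift r to NNReal using h0
    have hr : (r : ENNReal) < c.radius := lt_of_lt_of_le (by exact_mod_cast h1) h.r_le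
    simpa only [FormalMultilinearSeries.norm_apply_eq_norm_coef] using c.summable_norm_mul_pow hr
  · have hu' : u ∈ Metric.eball (0 : K) 1 := by
      rw [Metric.mem_eball, edist_zero_right, ← ofReal_norm, ENNReal.ofReal_lt_one]
      exact hu
    simpa only [FormalMultilinearSeries.apply_eq_pow_smul_coeff, smul_eq_mul, mul_comm]
      using h.hasSum hu'

theorem DiscSeries.coeff_eq_zero {K : Type*} [NontriviallyNormedField K] {f : K → K} {a : K}
    {c : ℕ → K} (h : DiscSeries f a c) (hf : ∀ u, ‖u‖ < 1 → f (a + u) = 0) (k : ℕ) : c k = 0 := by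
  have h1 : f =ᶠ[𝓝 a] 0 := by
    filter_upwards [Metric.ball_mem_nhds a one_pos] with z hz
    simpa using hf (z - a) (by simpa [dist_eq_norm] using hz)
  have h2 := (h.hasFPowerSeriesOnBall.hasFPowerSeriesAt.congr h1).eq_zero
  have h3 : (FormalMultilinearSeries.ofScalars K c).coeff k = 0 := by rw [h2]; rfl
  simpa using h3

variable {p : ℕ} [Fact p.Prime]

theorem IsColemanPolylog.discSeries {K : Type*} [NontriviallyNormedField K] {p : ℕ}
    {Li : ℕ → K → K} (h : IsColemanPolylog p Li) (n : ℕ) {a : K} (ha : a ∈ affinoid K) :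
    ∃ c, DiscSeries (Li n) a c :=
  have ⟨_, hc⟩ := h.locallyAnalytic n a ha
  ⟨_, discSeries_of_hasFPowerSeriesOnBall hc⟩

/-- The Frobenius transform of a Coleman polylogarithm is the limit of the Riemann sums. -/
theorem IsColemanPolylog.sub_eq_riemannLimit {Li : ℕ → ℂ_[p] → ℂ_[p]} (h : IsColemanPolylog p Li)
    (n : ℕ) : ∀ z ∈ affinoid ℂ_[p], Li n z - Li n (z ^ p) / (p : ℂ_[p]) ^ n = riemannLimit p n z := by
  have hp : p.Prime := Fact.out
  have hpK : (p : ℂ_[p]) ≠ 0 := by exact_mod_cast hp.ne_zero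
  have hpn : ‖(p : ℂ_[p])‖ < 1 := by
    have := norm_p_pow (p := p) (K := ℂ_[p]) 1
    rw [pow_one, pow_one] at this
    rw [this]; exact inv_p_lt_one
  have h0mem : (0 : ℂ_[p]) ∈ affinoid ℂ_[p] := by simp [affinoid]
  have hdisc : ∀ z : ℂ_[p], ‖z‖ < 1 → z ∈ affinoid ℂ_[p] := fun z hz =>
    mem_affinoid_of_close h0mem (by simpa using hz)
  -- The level `n` statement computes the derivative of the transform at level `n + 1`, which is the
  -- transform at level `n` divided by `z`.
  induction n with
  | zero =>
    intro z hz
    rw [riemannLimit_zero_left hz, h.zero z hz, h.zero _ (pow_mem_affinoid p hz), pow_zero, div_one]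
  | succ n ih =>
    intro z hz
    rw [← sub_eq_zero]
    refine ((h.frobenius (n + 1)).sub (isRigidAnalytic_riemannLimit p (n + 1))).eq_zero
      (fun z hz => ?_) hz
    set t : ℂ_[p] := ((p : ℂ_[p]) ^ (n + 1))⁻¹ with ht
    -- The expansion is centred at `p`, not at `0`: the derivative is prescribed only at nonzero
    -- points, and `p` is a nonzero point of the same residue disc.
    have hser : ∃ d, DiscSeries (fun z => Li (n + 1) z + (-t) * Li (n + 1) (z ^ p) +
        (-1) * riemannLimit p (n + 1) z) (p : ℂ_[p]) d := by
      have ha := hdisc _ hpn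
      obtain ⟨d1, h1⟩ := h.discSeries (n + 1) ha
      obtain ⟨d2, h2⟩ := h.discSeries (n + 1) (pow_mem_affinoid p ha)
      obtain ⟨d3, h3⟩ := discSeries_riemannLimit (p := p) (n + 1) ha
      -- The polynomial is the increment `z ^ p - p ^ p` in the coordinate `z - p`. Its coefficients
      -- are integral, so the composite converges on the whole disc.
      have h4 := h2.comp (a := (p : ℂ_[p]))
        ((Polynomial.X + Polynomial.C (p : ℂ_[p])) ^ p - Polynomial.C ((p : ℂ_[p]) ^ p)) ?_ ?_
      · have h5 : DiscSeries (fun z => Li (n + 1) (z ^ p)) (p : ℂ_[p]) _ :=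
          h4.congr fun z _ => by simp
        exact ⟨_, (h1.add (h5.smul (-t))).add (h3.smul (-1))⟩
      · simp [Polynomial.coeff_zero_eq_eval_zero]
      · intro i
        rw [Polynomial.coeff_sub]
        refine (norm_sub_le_max' _ _).trans (max_le (norm_coeff_X_add_C_pow_le ha.1 _ _) ?_)
        rw [Polynomial.coeff_C]
        split_ifs
        · rw [norm_pow]; exact pow_le_one₀ (norm_nonneg _) ha.1
        · simp
    have hder : ∀ a : ℂ_[p], ‖a‖ < 1 → a ≠ 0 → HasDerivAt (fun z => Li (n + 1) z +
        (-t) * Li (n + 1) (z ^ p) + (-1) * riemannLimit p (n + 1) z) 0 a := by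
      intro a ha1 ha0
      have ha := hdisc a ha1
      have d1 := h.deriv n a ha ha0
      have d2 := (h.deriv n (a ^ p) (pow_mem_affinoid p ha) (pow_ne_zero _ ha0)).comp a
        (hasDerivAt_pow p a)
      have d3 := hasDerivAt_riemannLimit (p := p) n ha ha0
      have d4 := (d1.fun_add (d2.const_mul (-t))).fun_add (d3.const_mul (-1))
      have e : Li n a / a + -t * (Li n (a ^ p) / a ^ p * ((p : ℂ_[p]) * a ^ (p - 1))) +
          -1 * (riemannLimit p n a / a) = 0 := by
        rw [← ih a ha]
        have hap : a ^ p = a * a ^ (p - 1) := (mul_pow_sub_one hp.ne_zero a).symm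
        generalize Li n (a ^ p) = y
        rw [hap, ht, pow_succ]
        field_simp
        ring
      rw [e] at d4
      exact d4
    obtain ⟨d, hd⟩ := hser
    have hconst := hd.eq_const (by
      filter_upwards [Metric.ball_mem_nhds (p : ℂ_[p]) one_pos, eventually_ne_nhds hpK] with y hy hy0
      refine hder y ?_ hy0
      have hy' : ‖y - p‖ < 1 := by simpa [dist_eq_norm] using hy
      simpa using norm_sub_lt_trans hy' (by simpa using hpn : ‖(p : ℂ_[p]) - 0‖ < 1))
    -- The constant is evaluated at `0`, where all three terms vanish.
    have hc0 := hconst 0 (by simpa using hpn)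
    have hcz := hconst z (norm_sub_lt_trans (by simpa using hz : ‖z - 0‖ < 1) (by simpa using hpn))
    rw [← hc0] at hcz
    simp only [zero_pow hp.ne_zero, h.apply_zero, riemannLimit_zero_right] at hcz
    rw [div_eq_mul_inv, ← ht]
    linear_combination hcz

end Uniqueness

/-! ### Elements periodic under the Frobenius modulo `p`. -/

section FrobeniusPeriodic

variable {A : Type*} [CommRing A] {p : ℕ}

/-- A period may be replaced by any multiple of it, since a congruence modulo `p` survives raising
to powers. This provides common periods, and arbitrarily long ones. -/
theorem dvd_pow_pow_mul_sub {x : A} {f : ℕ} (h : (p : A) ∣ x ^ p ^ f - x) (k : ℕ) :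
    (p : A) ∣ x ^ p ^ (f * k) - x := by
  induction k with
  | zero => simp
  | succ k ih =>
    have h1 : x ^ p ^ (f * (k + 1)) - x =
        ((x ^ p ^ (f * k)) ^ p ^ f - x ^ p ^ f) + (x ^ p ^ f - x) := by
      rw [← pow_mul, ← pow_add, Nat.mul_succ]; ring
    rw [h1]
    exact dvd_add (ih.trans (sub_dvd_pow_sub_pow _ _ _)) h

variable (A p) in
/-- The elements of a ring that are fixed modulo `p` by some power of the Frobenius. -/
def frobeniusPeriodic [Fact p.Prime] : Subring A where
  carrier := {x | ∃ f, 0 < f ∧ (p : A) ∣ x ^ p ^ f - x}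
  one_mem' := ⟨1, one_pos, by simp⟩
  zero_mem' := ⟨1, one_pos, by simp [(Fact.out : p.Prime).ne_zero]⟩
  mul_mem' := by
    rintro x y ⟨f, hf, hx⟩ ⟨g, hg, hy⟩
    refine ⟨f * g, Nat.mul_pos hf hg, ?_⟩
    have hx' := dvd_pow_pow_mul_sub hx g
    have hy' := dvd_pow_pow_mul_sub hy f
    rw [mul_comm g f] at hy'
    have h1 : (x * y) ^ p ^ (f * g) - x * y = (x ^ p ^ (f * g) - x) * y ^ p ^ (f * g) +
        x * (y ^ p ^ (f * g) - y) := by ring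
    rw [h1]
    exact dvd_add (hx'.mul_right _) (hy'.mul_left _)
  add_mem' := by
    rintro x y ⟨f, hf, hx⟩ ⟨g, hg, hy⟩
    refine ⟨f * g, Nat.mul_pos hf hg, ?_⟩
    have hx' := dvd_pow_pow_mul_sub hx g
    have hy' := dvd_pow_pow_mul_sub hy f
    rw [mul_comm g f] at hy'
    -- Modulo `p` the Frobenius is additive.
    obtain ⟨r, hr⟩ := exists_add_pow_prime_pow_eq (Fact.out : p.Prime) x y (f * g)
    have h1 : (x + y) ^ p ^ (f * g) - (x + y) = (x ^ p ^ (f * g) - x) + (y ^ p ^ (f * g) - y) +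
        p * (x * y * r) := by rw [hr]; ring
    rw [h1]
    exact dvd_add (dvd_add hx' hy') (dvd_mul_right _ _)
  neg_mem' := by
    rintro x ⟨f, hf, hx⟩
    refine ⟨f, hf, ?_⟩
    -- Expanding `(x + (-x)) ^ p ^ f = 0` avoids a case distinction on the parity of `p`.
    obtain ⟨r, hr⟩ := exists_add_pow_prime_pow_eq (Fact.out : p.Prime) x (-x) f
    rw [add_neg_cancel, zero_pow (pow_ne_zero _ (Fact.out : p.Prime).ne_zero)] at hr
    have h1 : (-x) ^ p ^ f - -x = -(x ^ p ^ f - x) + p * (x * x * r) := by linear_combination -hr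
    rw [h1]
    exact dvd_add hx.neg_right (dvd_mul_right _ _)

/-- By Euler's theorem `p ^ φ(m)` is congruent to `1` modulo `m`, so `x ^ p ^ φ(m) = x` holds
exactly. -/
theorem mem_frobeniusPeriodic_of_pow_eq_one [Fact p.Prime] {x : A} {m : ℕ} (hm : p.Coprime m)
    (hx : x ^ m = 1) : x ∈ frobeniusPeriodic A p := by
  have hm0 : 0 < m := by
    refine Nat.pos_of_ne_zero fun h => (Fact.out : p.Prime).one_lt.ne' ?_
    simpa [h] using hm
  refine ⟨m.totient, Nat.totient_pos.2 hm0, ?_⟩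
  have h1 : 1 ≡ p ^ m.totient [MOD m] := (Nat.ModEq.pow_totient hm).symm
  obtain ⟨t, ht⟩ := (Nat.modEq_iff_dvd' (Nat.one_le_pow _ _ (Fact.out : p.Prime).pos)).1 h1
  have h2 : p ^ m.totient = m * t + 1 := by
    have := Nat.one_le_pow m.totient p (Fact.out : p.Prime).pos
    omega
  rw [h2, pow_succ, pow_mul, hx]
  simp

end FrobeniusPeriodic

/-! ### Arithmetic of `W`, its roots of unity, and integrality of the polylogarithms there. -/

section WittRing

variable {p : ℕ} [Fact p.Prime]

theorem norm_natCast_prime_lt_one : ‖(p : ℂ_[p])‖ < 1 := by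
  have := norm_p_pow (p := p) (K := ℂ_[p]) 1
  rw [pow_one, pow_one] at this
  rw [this]; exact inv_p_lt_one

theorem natCast_prime_ne_zero : (p : ℂ_[p]) ≠ 0 := by
  exact_mod_cast (Fact.out : p.Prime).ne_zero

theorem isClosed_wittRing : IsClosed (wittRing p : Set ℂ_[p]) :=
  Subring.isClosed_topologicalClosure _

theorem norm_le_one_of_mem_wittRing {x : ℂ_[p]} (hx : x ∈ wittRing p) : ‖x‖ ≤ 1 := by
  let O : Subring ℂ_[p] :=
    { carrier := {x | ‖x‖ ≤ 1}
      one_mem' := by simp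
      zero_mem' := by simp
      mul_mem' := fun {x y} hx hy => by
        simp only [Set.mem_ofPred_eq, norm_mul] at hx hy ⊢
        exact mul_le_one₀ hx (norm_nonneg _) hy
      add_mem' := fun {x y} hx hy =>
        (IsUltrametricDist.norm_add_le_max x y).trans (max_le hx hy)
      neg_mem' := fun {x} hx => by simpa using hx }
  refine Subring.topologicalClosure_minimal _ (t := O) (Subring.closure_le.2 ?_)
    (isClosed_le continuous_norm continuous_const) hx
  rintro ζ ⟨m, hm, hζ⟩
  have hm0 : m ≠ 0 := by
    rintro rfl
    exact (Fact.out : p.Prime).one_lt.ne' (by simpa using hm)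
  have h1 : ‖ζ‖ ^ m = 1 := by rw [← norm_pow, hζ, norm_one]
  exact ((pow_eq_one_iff_of_nonneg (norm_nonneg _) hm0).1 h1).le

/-- Partial sums stay in the closed subring `W`. This is how integrality passes to all the infinite
series below. -/
theorem hasSum_mem_wittRing {ι : Type*} {f : ι → ℂ_[p]} {s : ℂ_[p]} (hf : ∀ i, f i ∈ wittRing p)
    (h : HasSum f s) : s ∈ wittRing p :=
  isClosed_wittRing.mem_of_tendsto h (Eventually.of_forall fun _ => sum_mem fun i _ => hf i)

theorem mem_wittRing_of_forall_close {x : ℂ_[p]}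
    (h : ∀ ε > 0, ∃ y ∈ wittRing p, ‖x - y‖ < ε) : x ∈ wittRing p := by
  rw [← SetLike.mem_coe, ← isClosed_wittRing.closure_eq, Metric.mem_closure_iff]
  simpa only [dist_eq_norm, SetLike.mem_coe] using h

/-- An element of `W` of norm less than `1` is divisible by `p` in `W`. -/
theorem div_prime_mem_wittRing {x : ℂ_[p]} (hx : x ∈ wittRing p) (hx1 : ‖x‖ < 1) :
    x / p ∈ wittRing p := by
  have hp0 : 0 < ‖(p : ℂ_[p])‖ := norm_pos_iff.2 natCast_prime_ne_zero
  set S := {ζ : ℂ_[p] | ∃ m : ℕ, p.Coprime m ∧ ζ ^ m = 1} with hS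
  have hle : Subring.closure S ≤ wittRing p := Subring.le_topologicalClosure _
  -- The periodic elements form a subring containing the generators. Divisibility is taken inside
  -- the generated subring, so that the quotient by `p` stays in it.
  have hper : Subring.closure S ≤
      (frobeniusPeriodic (Subring.closure S) p).map (Subring.closure S).subtype := by
    refine Subring.closure_le.2 ?_
    rintro ζ ⟨m, hm, hζ⟩
    refine ⟨⟨ζ, Subring.subset_closure ⟨m, hm, hζ⟩⟩,
      mem_frobeniusPeriodic_of_pow_eq_one hm (Subtype.ext hζ), rfl⟩
  -- For each `k` there is `c` in the generated subring with `y ^ p ^ (f * k) - y = p * c`. Since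
  -- `‖y‖ < 1` the power tends to `0` with growing `k`, so `y / p` is the limit of the elements
  -- `-c`.
  have hR : ∀ y ∈ Subring.closure S, ‖y‖ < 1 → y / p ∈ wittRing p := by
    intro y hy hy1
    obtain ⟨y, ⟨f, hf, hfy⟩, rfl⟩ := hper hy
    refine mem_wittRing_of_forall_close fun ε hε => ?_
    obtain ⟨k, hk⟩ := exists_pow_lt_of_lt_one (mul_pos hε hp0) hy1
    obtain ⟨c, hc⟩ := dvd_pow_pow_mul_sub hfy k
    refine ⟨-c, hle (neg_mem c.2), ?_⟩
    have hc' : (y : ℂ_[p]) ^ p ^ (f * k) - y = p * c := by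
      have := congrArg (Subring.closure S).subtype hc
      simpa using this
    have e : (y : ℂ_[p]) / p - -c = y ^ p ^ (f * k) / p := by
      have := natCast_prime_ne_zero (p := p)
      field_simp
      linear_combination -hc'
    rw [Subring.coe_subtype] at hk hy1 ⊢
    rw [e, norm_div, div_lt_iff₀ hp0, norm_pow]
    refine lt_of_le_of_lt (pow_le_pow_of_le_one (norm_nonneg _) hy1.le ?_) hk
    calc k ≤ f * k := Nat.le_mul_of_pos_left k hf
      _ ≤ p ^ (f * k) := (Nat.lt_pow_self (Fact.out : p.Prime).one_lt).le
  refine mem_wittRing_of_forall_close fun ε hε => ?_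
  have hx' : x ∈ closure (Subring.closure S : Set ℂ_[p]) := hx
  -- The bound `1` keeps `‖y‖ < 1`; the bound `ε * ‖p‖` absorbs the division by `p`.
  obtain ⟨y, hy, hxy⟩ := Metric.mem_closure_iff.1 hx' (min 1 (ε * ‖(p : ℂ_[p])‖))
    (lt_min one_pos (mul_pos hε hp0))
  rw [dist_eq_norm, lt_min_iff] at hxy
  refine ⟨y / p, hR y hy ?_, ?_⟩
  · have : y = x - (x - y) := by ring
    rw [this]; exact (norm_sub_le_max' _ _).trans_lt (max_lt hx1 hxy.1)
  · rw [← sub_div, norm_div, div_lt_iff₀ hp0]; exact hxy.2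

theorem inv_one_sub_mem_wittRing {m : ℂ_[p]} (hm : m ∈ wittRing p) (h : ‖m‖ < 1) :
    (1 - m)⁻¹ ∈ wittRing p :=
  hasSum_mem_wittRing (fun k => pow_mem hm k) (hasSum_geometric_of_norm_lt_one h)

/-- With `f` a period of the residue class of `x`, the power `x ^ (p ^ f - 1)` is `1 - m` with `‖m‖
< 1`, and its inverse is a geometric series in `W`. Multiplying by `x ^ (p ^ f - 2)` gives the
inverse of `x`. -/
theorem inv_mem_wittRing {x : ℂ_[p]} (hx : x ∈ wittRing p) (h : ‖x‖ = 1) :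
    x⁻¹ ∈ wittRing p := by
  have hx0 : x ≠ 0 := by rw [← norm_ne_zero_iff, h]; exact one_ne_zero
  obtain ⟨f, hf, hfx⟩ := exists_period x h.le
  have hq : 2 ≤ p ^ f := (Fact.out : p.Prime).two_le.trans (Nat.le_self_pow hf.ne' p)
  obtain ⟨q, hq⟩ := Nat.exists_eq_add_of_le hq
  have hpow : x ^ p ^ f = x ^ (q + 1) * x := by rw [hq, ← pow_succ]; ring
  have hm : ‖1 - x ^ (q + 1)‖ < 1 := by
    have e : x ^ p ^ f - x = -((1 - x ^ (q + 1)) * x) := by rw [hpow]; ring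
    rwa [e, norm_neg, norm_mul, h, mul_one] at hfx
  have h1 := inv_one_sub_mem_wittRing (sub_mem (one_mem _) (pow_mem hx (q + 1))) hm
  rw [sub_sub_cancel] at h1
  have e : x⁻¹ = x ^ q * (x ^ (q + 1))⁻¹ := by
    rw [pow_succ]; field_simp
  rw [e]
  exact mul_mem (pow_mem hx q) h1

theorem inv_natCast_mem_wittRing {k : ℕ} (hk : ¬ p ∣ k) : (k : ℂ_[p])⁻¹ ∈ wittRing p := by
  refine inv_mem_wittRing (natCast_mem _ k) ?_
  rw [norm_natCast_eq (p := p)]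
  exact (Padic.norm_natCast_eq_one_iff).2 ((Nat.Prime.coprime_iff_not_dvd Fact.out).2 hk)

/-- For odd `p`, a root of unity that is congruent to `1` modulo `p` is `1`. -/
theorem eq_one_of_pow_eq_one (hp2 : p ≠ 2) {η : ℂ_[p]} (hη : ‖η - 1‖ ≤ ‖(p : ℂ_[p])‖) {m : ℕ}
    (hm : 0 < m) (h : η ^ m = 1) : η = 1 := by
  by_contra hne
  have hp3 : 3 ≤ p := by have := (Fact.out : p.Prime).two_le; omega
  have hx0 : 0 < ‖η - 1‖ := norm_pos_iff.2 (sub_ne_zero.2 hne)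
  have hm0 : 0 < ‖(m : ℂ_[p])‖ := norm_pos_iff.2 (Nat.cast_ne_zero.2 hm.ne')
  -- In the binomial expansion of `η ^ m = 1` the linear term `m (η - 1)` strictly dominates all
  -- higher terms, which is impossible unless `η = 1`.
  have hexp := add_pow (η - 1) 1 m
  rw [sub_add_cancel, h, Finset.sum_range_succ'] at hexp
  obtain ⟨m, rfl⟩ := Nat.exists_eq_succ_of_ne_zero hm.ne'
  rw [Nat.succ_eq_add_one, Finset.sum_range_succ'] at hexp
  simp only [one_pow, mul_one, pow_zero, zero_add, pow_one, Nat.choose_one_right, Nat.choose_zero_right,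
    Nat.cast_one] at hexp
  have heq : (η - 1) * ((m + 1 : ℕ) : ℂ_[p]) = -∑ k ∈ Finset.range m,
      (η - 1) ^ (k + 1 + 1) * ((m + 1).choose (k + 1 + 1) : ℂ_[p]) := by
    linear_combination -hexp
  have hlt : ‖∑ k ∈ Finset.range m, (η - 1) ^ (k + 1 + 1) * ((m + 1).choose (k + 1 + 1) : ℂ_[p])‖ <
      ‖η - 1‖ * ‖((m + 1 : ℕ) : ℂ_[p])‖ := by
    rcases Nat.eq_zero_or_pos m with rfl | hmpos
    · simpa using hx0
    obtain ⟨k, hkm, hk⟩ := IsUltrametricDist.exists_norm_finsetSum_le_of_nonempty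
      (Finset.nonempty_range_iff.2 hmpos.ne')
      (fun k => (η - 1) ^ (k + 1 + 1) * ((m + 1).choose (k + 1 + 1) : ℂ_[p]))
    refine lt_of_le_of_lt hk ?_
    have hj0 : 0 < ‖((k + 2 : ℕ) : ℂ_[p])‖ := norm_pos_iff.2 (Nat.cast_ne_zero.2 (Nat.succ_ne_zero _))
    -- From `j * choose N j = N * choose (N - 1) (j - 1)` with `N = m + 1` and `j = k + 2`.
    have hchoose : ‖((m + 1).choose (k + 2) : ℂ_[p])‖ * ‖((k + 2 : ℕ) : ℂ_[p])‖ ≤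
        ‖((m + 1 : ℕ) : ℂ_[p])‖ := by
      rw [← norm_mul, ← Nat.cast_mul, ← Nat.add_one_mul_choose_eq, Nat.cast_mul, norm_mul]
      exact mul_le_of_le_one_right (norm_nonneg _) (IsUltrametricDist.norm_natCast_le_one _ _)
    have hpw : ‖η - 1‖ ^ (k + 1) < ‖((k + 2 : ℕ) : ℂ_[p])‖ := by
      have h1 : ‖η - 1‖ ^ (k + 1) ≤ (((p ^ (k + 1) : ℕ)) : ℝ)⁻¹ := by
        refine (pow_le_pow_left₀ (norm_nonneg _) hη _).trans_eq ?_
        rw [← norm_pow, ← Nat.cast_pow, norm_p_pow]; push_cast; rw [inv_pow]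
      have h2 := norm_inv_natCast_le p (K := ℂ_[p]) (k + 2)
      rw [norm_inv] at h2
      -- This needs `p ≥ 3`. For `p = 2` and `k = 0` it is an equality, in accordance with the root
      -- of unity `-1`, congruent to `1` modulo `2`.
      have h3 : k + 2 < p ^ (k + 1) := by
        refine lt_of_lt_of_le ?_ (Nat.pow_le_pow_left hp3 (k + 1))
        clear * -
        induction k with
        | zero => norm_num
        | succ k ih => rw [pow_succ]; omega
      have h3' : ((k + 2 : ℕ) : ℝ) < ((p ^ (k + 1) : ℕ) : ℝ) := by exact_mod_cast h3
      refine h1.trans_lt (lt_of_lt_of_le (inv_strictAnti₀ (by positivity) h3') ?_)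
      exact inv_le_of_inv_le₀ hj0 h2
    rw [norm_mul, norm_pow]
    calc ‖η - 1‖ ^ (k + 1 + 1) * ‖((m + 1).choose (k + 1 + 1) : ℂ_[p])‖
        = ‖η - 1‖ * (‖((m + 1).choose (k + 2) : ℂ_[p])‖ * ‖η - 1‖ ^ (k + 1)) := by
          rw [pow_succ]; ring
      _ < ‖η - 1‖ * ‖((m + 1 : ℕ) : ℂ_[p])‖ := by
        refine mul_lt_mul_of_pos_left (lt_of_lt_of_le ?_ hchoose) hx0
        refine mul_lt_mul_of_pos_left hpw (norm_pos_iff.2 ?_)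
        have := Finset.mem_range.1 hkm
        exact Nat.cast_ne_zero.2 (Nat.choose_pos (by omega)).ne'
  rw [← norm_mul, heq, norm_neg] at hlt
  exact lt_irrefl _ hlt

theorem inv_one_sub_pow_mem_wittRing {z : ℂ_[p]} (hz : z ∈ wittRing p) (hza : z ∈ affinoid ℂ_[p])
    (m : ℕ) : (1 - z ^ p ^ m)⁻¹ ∈ wittRing p :=
  inv_mem_wittRing (sub_mem (one_mem _) (pow_mem hz _))
    (norm_one_sub_eq (pow_pow_mem_affinoid p hza m))

theorem primeToPow_mem_wittRing (n i : ℕ) : primeToPow p ℂ_[p] n i ∈ wittRing p := by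
  unfold primeToPow
  split_ifs with h
  · exact zero_mem _
  · rw [← inv_pow]; exact pow_mem (inv_natCast_mem_wittRing h) n

/-- The coefficients of the Riemann sums involve only inverses of integers prime to `p`, and the
denominators `1 - z ^ p ^ m` are units of `W`. -/
theorem riemannLimit_mem_wittRing (n : ℕ) {z : ℂ_[p]} (hz : z ∈ wittRing p)
    (hza : z ∈ affinoid ℂ_[p]) : riemannLimit p n z ∈ wittRing p := by
  refine hasSum_mem_wittRing (fun l => ?_) (summable_riemannDiff n hza).hasSum
  rw [riemannDiff, combo, div_eq_mul_inv]
  exact mul_mem (sum_mem fun i _ => mul_mem (sub_mem (primeToPow_mem_wittRing n _)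
    (primeToPow_mem_wittRing n _)) (pow_mem hz i)) (inv_one_sub_pow_mem_wittRing hz hza _)

theorem mem_affinoid_of_mem_unitSet {z : ℂ_[p]} (hz : z ∈ unitSet p) : z ∈ affinoid ℂ_[p] :=
  ⟨hz.2.1.le, hz.2.2.ge⟩

/-- For odd `p`, the roots of unity in `W` are fixed by a power of `x ↦ x ^ p`. -/
theorem exists_pow_pow_eq_self (hp2 : p ≠ 2) {α : ℂ_[p]} (hα : α ∈ wittRing p) {m : ℕ} (hm : 0 < m)
    (h : α ^ m = 1) : ∃ f, 0 < f ∧ α ^ p ^ f = α := by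
  have hα0 : α ≠ 0 := by
    rintro rfl
    rw [zero_pow hm.ne'] at h
    exact zero_ne_one h
  have hα1 : ‖α‖ = 1 := by
    refine (pow_eq_one_iff_of_nonneg (norm_nonneg _) hm.ne').1 ?_
    rw [← norm_pow, h, norm_one]
  obtain ⟨f, hf, hfα⟩ := exists_period α hα1.le
  refine ⟨f, hf, ?_⟩
  -- Since `W` is unramified, the congruence modulo the maximal ideal given by the period is already
  -- a congruence modulo `p`. The quotient `α ^ p ^ f / α` is then a root of unity congruent to `1`
  -- modulo `p`.
  have hc := norm_le_one_of_mem_wittRing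
    (div_prime_mem_wittRing (sub_mem (pow_mem hα (p ^ f)) hα) hfα)
  rw [norm_div, div_le_one (norm_pos_iff.2 natCast_prime_ne_zero)] at hc
  have h1 : α ^ p ^ f / α = 1 := by
    refine eq_one_of_pow_eq_one hp2 ?_ hm ?_
    · rw [div_sub_one hα0, norm_div, hα1, div_one]; exact hc
    · rw [div_pow, ← pow_mul, mul_comm, pow_mul, h, one_pow, div_one]
  exact (div_eq_one_iff_eq hα0).1 h1

/-- For the normalized functions the Frobenius relation reads `p ^ n * F z - F (z ^ p) =
riemannLimit p n z`, with right side in `W`. It is telescoped along the Frobenius orbit of `z`. -/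
theorem pow_mul_sub_mem_wittRing (n f : ℕ) : ∀ {z : ℂ_[p]}, z ∈ wittRing p → z ∈ affinoid ℂ_[p] →
    ((p : ℂ_[p]) ^ n) ^ f * normalizedPolylog p n z - normalizedPolylog p n (z ^ p ^ f) ∈
      wittRing p := by
  induction f with
  | zero => intro z _ _; simp
  | succ f ih =>
    intro z hz hza
    have hp0 := pow_ne_zero n (natCast_prime_ne_zero (p := p))
    have hG := (isColemanPolylog_polylog p).sub_eq_riemannLimit n z hza
    have hGm := riemannLimit_mem_wittRing n hz hza
    have hstep := ih (pow_mem hz p) (pow_mem_affinoid p hza)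
    have e : ((p : ℂ_[p]) ^ n) ^ (f + 1) * normalizedPolylog p n z -
        normalizedPolylog p n (z ^ p ^ (f + 1)) =
        ((p : ℂ_[p]) ^ n) ^ f * riemannLimit p n z + (((p : ℂ_[p]) ^ n) ^ f *
          normalizedPolylog p n (z ^ p) - normalizedPolylog p n ((z ^ p) ^ p ^ f)) := by
      rw [← pow_mul z, ← pow_succ', ← hG]
      simp only [normalizedPolylog]
      field_simp
      ring
    rw [e]
    exact add_mem (mul_mem (pow_mem (pow_mem (natCast_mem _ p) n) f) hGm) hstep

/-- The normalized polylogarithm is integral at roots of unity. -/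
theorem normalizedPolylog_mem_wittRing {n : ℕ} (hn : n = 0 ∨ p ≠ 2) {α : ℂ_[p]}
    (hα : α ∈ unitSet p) (hroot : ∃ m : ℕ, 0 < m ∧ α ^ m = 1) :
    normalizedPolylog p n α ∈ wittRing p := by
  have hαa := mem_affinoid_of_mem_unitSet hα
  -- At level `0` the factor `1 - p ^ (n * f)` used below vanishes, but there the function is the
  -- explicit `α / (1 - α)`.
  rcases Nat.eq_zero_or_pos n with rfl | hn0
  · rw [normalizedPolylog, pow_zero, div_one, (isColemanPolylog_polylog p).zero α hαa,
      div_eq_mul_inv]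
    exact mul_mem hα.1 (by simpa using inv_one_sub_pow_mem_wittRing hα.1 hαa 0)
  obtain ⟨m, hm, hαm⟩ := hroot
  obtain ⟨f, hf, hfα⟩ := exists_pow_pow_eq_self (hn.resolve_left hn0.ne') hα.1 hm hαm
  have h := pow_mul_sub_mem_wittRing n f hα.1 hαa
  have hlt : ‖((p : ℂ_[p]) ^ n) ^ f‖ < 1 := by
    rw [← pow_mul, norm_pow]
    exact pow_lt_one₀ (norm_nonneg _) norm_natCast_prime_lt_one (Nat.mul_pos hn0 hf).ne'
  have hinv := inv_one_sub_mem_wittRing (pow_mem (pow_mem (natCast_mem _ p) n) f) hlt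
  have hne : (1 : ℂ_[p]) - ((p : ℂ_[p]) ^ n) ^ f ≠ 0 := by
    rw [sub_ne_zero]
    intro h1
    rw [← h1, norm_one] at hlt
    exact lt_irrefl _ hlt
  -- As `α` returns to itself, both values in the telescoped relation are the same number,
  -- multiplied in total by `p ^ (n * f) - 1`, a unit of `W`.
  rw [hfα] at h
  have e : normalizedPolylog p n α = -((1 - ((p : ℂ_[p]) ^ n) ^ f)⁻¹ *
      (((p : ℂ_[p]) ^ n) ^ f * normalizedPolylog p n α - normalizedPolylog p n α)) := by
    field_simp
    ring
  rw [e]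
  exact neg_mem (mul_mem hinv h)

end WittRing

/-! ### Taylor coefficients at a point of `X` and their congruences. -/

section TaylorExpansion

variable {K : Type*} [NontriviallyNormedField K]

theorem ConvOnDisc.deriv {c : ℕ → K} (hc : ConvOnDisc c) :
    ConvOnDisc fun k => ((k + 1 : ℕ) : K) * c (k + 1) := by
  intro r h0 h1
  obtain ⟨s, hrs, hs1⟩ := exists_between h1
  have hs0 : 0 < s := h0.trans_lt hrs
  refine Summable.of_nonneg_of_le (fun k => by positivity) (fun k => ?_)
    (((summable_nat_add_iff 1).2 (hc.mul_nat hs0.le hs1)).mul_left (s⁻¹ * ‖(1 : K)‖))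
  have hnat : ‖((k + 1 : ℕ) : K)‖ ≤ (k + 1 : ℕ) * ‖(1 : K)‖ := by
    simpa using norm_nsmul_le (n := k + 1) (a := (1 : K))
  rw [norm_mul]
  calc ‖((k + 1 : ℕ) : K)‖ * ‖c (k + 1)‖ * r ^ k
      ≤ ((k + 1 : ℕ) * ‖(1 : K)‖) * ‖c (k + 1)‖ * s ^ k := by gcongr
    _ = _ := by rw [pow_succ]; field_simp

theorem DiscSeries.deriv [CompleteSpace K] [IsUltrametricDist K] {f f' : K → K} {a : K} {c : ℕ → K}
    (hf : DiscSeries f a c) (hf' : ∀ u, ‖u‖ < 1 → HasDerivAt f (f' (a + u)) (a + u)) :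
    DiscSeries f' a (fun k => ((k + 1 : ℕ) : K) * c (k + 1)) := by
  refine ⟨hf.1.deriv, fun u hu => ?_⟩
  have hs : Summable fun k : ℕ => c (k + 1) * (u ^ (k + 1 - 1) * ((k + 1 : ℕ) : K)) := by
    refine Summable.of_norm ((hf.1.deriv ‖u‖ (norm_nonneg u) hu).congr fun k => ?_)
    rw [Nat.add_sub_cancel, norm_mul, norm_mul, norm_mul, norm_pow]; ring
  have hs' : Summable fun k : ℕ => c k * (u ^ (k - 1) * (k : K)) := (summable_nat_add_iff 1).1 hs
  rw [(hf' u hu).unique (hf.hasDerivAt_tsum hu), hs'.tsum_eq_zero_add]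
  simp only [Nat.cast_zero, mul_zero, zero_add]
  refine hs.hasSum.congr_fun fun k => ?_
  rw [Nat.add_sub_cancel]; ring

theorem ConvOnDisc.natCast_mul {c : ℕ → K} (hc : ConvOnDisc c) :
    ConvOnDisc fun k => (k : K) * c k := by
  intro r h0 h1
  refine Summable.of_nonneg_of_le (fun k => by positivity) (fun k => ?_)
    ((hc.mul_nat h0 h1).mul_left ‖(1 : K)‖)
  have hnat : ‖(k : K)‖ ≤ k * ‖(1 : K)‖ := by
    simpa using norm_nsmul_le (n := k) (a := (1 : K))
  rw [norm_mul]
  calc ‖(k : K)‖ * ‖c k‖ * r ^ k ≤ (k * ‖(1 : K)‖) * ‖c k‖ * r ^ k := by gcongr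
    _ = _ := by ring

/-- If `z * f' z = g z` on a disc, then the Taylor coefficients of `f` and `g` satisfy the
corresponding recursion. -/
theorem DiscSeries.coeff_recursion [CompleteSpace K] [IsUltrametricDist K] {f g : K → K} {a : K}
    {c d : ℕ → K} (ha : ‖a‖ = 1) (hf : DiscSeries f a c) (hg : DiscSeries g a d)
    (hD : ∀ z, ‖z - a‖ < 1 → HasDerivAt f (g z / z) z) (k : ℕ) :
    a * (((k + 1 : ℕ) : K) * c (k + 1)) + k * c k = d k := by
  have hF := hf.deriv (f' := fun z => g z / z) fun u hu => hD _ (by simpa using hu)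
  -- The equation `z f' = g` is written as `a f' + (z - a) f' - g = 0`, and the coefficients of this
  -- zero function are read off.
  have hG : DiscSeries (fun z => (z - a) * (g z / z)) a (fun k => (k : K) * c k) := by
    refine ⟨hf.1.natCast_mul, fun u hu => ?_⟩
    rw [← hasSum_nat_add_iff' 1]
    simp only [Finset.range_one, Finset.sum_singleton, Nat.cast_zero, zero_mul, sub_zero,
      add_sub_cancel_left]
    refine ((hF.2 u hu).mul_left u).congr_fun fun k => ?_
    rw [pow_succ]; ring
  have h := ((hF.smul a).add hG).add (hg.smul (-1))
  have h0 := h.coeff_eq_zero (fun u hu => ?_) k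
  · linear_combination h0
  · have hz : a + u ≠ 0 := by
      intro h
      rw [← norm_neg, ← eq_neg_of_add_eq_zero_left h, ha] at hu
      exact lt_irrefl _ hu
    field_simp
    ring

/-- The geometric series of `z / (1 - z) = 1 / (1 - z) - 1`. The coefficients are made explicit
because their integrality starts the induction on the level. -/
theorem discSeries_div_one_sub [IsUltrametricDist K] [CompleteSpace K] {a : K}
    (ha : a ∈ affinoid K) :
    DiscSeries (fun z => z / (1 - z)) a
      (fun k => ((1 - a)⁻¹) ^ (k + 1) + if k = 0 then -1 else 0) := by
  have h1 := norm_one_sub_eq ha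
  have h1' : (1 : K) - a ≠ 0 := by rw [← norm_ne_zero_iff, h1]; exact one_ne_zero
  have hgeo : DiscSeries (fun z => (1 - z)⁻¹) a (fun k => ((1 - a)⁻¹) ^ (k + 1)) := by
    refine ⟨ConvOnDisc.of_bounded (B := 1) fun k => by simp [h1], fun u hu => ?_⟩
    have hn : ‖(1 - a)⁻¹ * u‖ < 1 := by rw [norm_mul, norm_inv, h1]; simpa using hu
    have h := (hasSum_geometric_of_norm_lt_one hn).mul_left (1 - a)⁻¹
    have e : (1 - a)⁻¹ * (1 - (1 - a)⁻¹ * u)⁻¹ = (1 - (a + u))⁻¹ := by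
      rw [← mul_inv, mul_sub, mul_one, mul_inv_cancel_left₀ h1', sub_sub]
    rw [e] at h
    refine h.congr_fun fun k => ?_
    simp only [mul_pow, pow_succ']; ring
  refine (hgeo.add (DiscSeries.const a (-1))).congr fun z hz => ?_
  have hz1 : (1 : K) - z ≠ 0 := by
    rw [← norm_ne_zero_iff, norm_one_sub_eq (mem_affinoid_of_close ha hz)]; exact one_ne_zero
  field_simp
  ring

variable {p : ℕ} [Fact p.Prime]

/-- The Taylor expansion of the polylogarithms in the coordinate `x = z / α - 1`. -/
theorem exists_taylor_coeff {α : ℂ_[p]} (hα : α ∈ unitSet p) : ∃ A : ℕ → ℕ → ℂ_[p],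
    (∀ n, A n 0 = polylog p n α) ∧ (∀ k, A 0 k ∈ wittRing p) ∧
    (∀ n k, ((k + 1 : ℕ) : ℂ_[p]) * A (n + 1) (k + 1) + k * A (n + 1) k = A n k) ∧
    ∀ n x, ‖x‖ < 1 → HasSum (fun k => A n k * x ^ k) (polylog p n (α * (1 + x))) := by
  have hαa := mem_affinoid_of_mem_unitSet hα
  have hLi := isColemanPolylog_polylog p
  -- At level `0` the explicit series is chosen, so that its coefficients are known to lie in `W`.
  have hex : ∀ n, ∃ c, DiscSeries (polylog p n) α c ∧ (n = 0 → ∀ k, c k ∈ wittRing p) := by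
    intro n
    rcases Nat.eq_zero_or_pos n with rfl | hn
    · refine ⟨_, (discSeries_div_one_sub hαa).congr fun z hz =>
        (hLi.zero z (mem_affinoid_of_close hαa hz)).symm, fun _ k => ?_⟩
      refine add_mem (pow_mem (by simpa using inv_one_sub_pow_mem_wittRing hα.1 hαa 0) _) ?_
      split_ifs
      · exact neg_mem (one_mem _)
      · exact zero_mem _
    · obtain ⟨c, hc⟩ := hLi.discSeries n hαa
      exact ⟨c, hc, fun h => absurd h hn.ne'⟩
  choose c hc hc0 using hex
  have hsum : ∀ n x, ‖x‖ < 1 →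
      HasSum (fun k => c n k * α ^ k * x ^ k) (polylog p n (α * (1 + x))) := by
    intro n x hx
    have h := (hc n).2 (α * x) (by rwa [norm_mul, hα.2.1, one_mul])
    rw [mul_add, mul_one]
    refine h.congr_fun fun k => ?_
    rw [mul_pow, mul_assoc]
  -- The substitution `z - α = α * x` multiplies the `k`-th coefficient by `α ^ k`, which also
  -- clears the factor `α` from the recursion.
  refine ⟨fun n k => c n k * α ^ k, fun n => ?_, fun k => mul_mem (hc0 0 rfl k) (pow_mem hα.1 k),
    fun n k => ?_, hsum⟩
  · have h := (hsum n 0 (by simp)).unique (hasSum_single 0 fun k hk => by simp [hk])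
    simpa using h.symm
  · have h := (hc (n + 1)).coeff_recursion hα.2.1 (hc n) (fun z hz => ?_) k
    · simp only [← h, pow_succ]; ring
    · refine hLi.deriv n z (mem_affinoid_of_close hαa hz) ?_
      rintro rfl
      rw [zero_sub, norm_neg, hα.2.1] at hz
      exact lt_irrefl _ hz

/-- The cofactor in `k!` of its exact power of `p` is a unit of `W`. -/
theorem pow_div_factorial_mem_wittRing {j k : ℕ} (h : padicValNat p k.factorial ≤ j) :
    (p : ℂ_[p]) ^ j / (k.factorial : ℂ_[p]) ∈ wittRing p := by
  have hp0 := natCast_prime_ne_zero (p := p)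
  obtain ⟨m, hm⟩ : p ^ padicValNat p k.factorial ∣ k.factorial := pow_padicValNat_dvd
  have hpm : ¬ p ∣ m := by
    rintro ⟨l, rfl⟩
    refine pow_succ_padicValNat_not_dvd (p := p) k.factorial_ne_zero ⟨l, ?_⟩
    rw [pow_succ, mul_assoc]; exact hm
  have hm0 : (m : ℂ_[p]) ≠ 0 := by
    refine Nat.cast_ne_zero.2 ?_
    rintro rfl
    exact hpm (dvd_zero p)
  obtain ⟨i, rfl⟩ := Nat.exists_eq_add_of_le h
  have e : (p : ℂ_[p]) ^ (padicValNat p k.factorial + i) / (k.factorial : ℂ_[p]) =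
      p ^ i * (m : ℂ_[p])⁻¹ := by
    have hcast : (k.factorial : ℂ_[p]) = p ^ padicValNat p k.factorial * m := by
      exact_mod_cast hm
    rw [hcast, pow_add]
    field_simp
  rw [e]
  exact mul_mem (pow_mem (natCast_mem _ p) i) (inv_natCast_mem_wittRing hpm)

/-- Let `v` be the valuation of `k!`. If `v = 0` the claim is `n < k`. Otherwise Legendre's formula
gives `k > (p - 1) v ≥ (n + 1) v ≥ v + n`. The case `k = p`, `v = 1` shows that `n + 1 < p` cannot
be weakened here. -/
theorem padicValNat_factorial_add_lt {n k : ℕ} (hn : n + 1 < p) (hk : n < k) :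
    padicValNat p k.factorial + n + 1 ≤ k := by
  have h := sub_one_mul_padicValNat_factorial_lt_of_ne_zero p (by omega : k ≠ 0)
  rcases Nat.eq_zero_or_pos (padicValNat p k.factorial) with h0 | h0
  · omega
  obtain ⟨q, rfl⟩ : ∃ q, p = q + n + 2 := ⟨p - n - 2, by omega⟩
  rw [show q + n + 2 - 1 = q + n + 1 by omega] at h
  nlinarith [Nat.zero_le (q * padicValNat (q + n + 2) k.factorial), Nat.mul_le_mul_left n h0]

variable {A : ℕ → ℕ → ℂ_[p]} {n : ℕ}

/-- After multiplication by `k!` the recursion has no denominators: `(k+1)! A (n+1) (k+1) = k! A n k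
- k * (k! A (n+1) k)`. It is solved from the edges `A 0 k` and `A m 0`. -/
theorem factorial_mul_coeff_mem_wittRing (hA0 : ∀ k, A 0 k ∈ wittRing p)
    (hrec : ∀ n k, ((k + 1 : ℕ) : ℂ_[p]) * A (n + 1) (k + 1) + k * A (n + 1) k = A n k)
    (hA : ∀ m ≤ n, A m 0 ∈ wittRing p) (k : ℕ) : (k.factorial : ℂ_[p]) * A n k ∈ wittRing p := by
  induction n generalizing k with
  | zero => exact mul_mem (natCast_mem _ _) (hA0 k)
  | succ n ih =>
    induction k with
    | zero => simpa using hA (n + 1) le_rfl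
    | succ k ihk =>
      have e : ((k + 1).factorial : ℂ_[p]) * A (n + 1) (k + 1) =
          k.factorial * A n k - k * (k.factorial * A (n + 1) k) := by
        rw [← hrec n k, Nat.factorial_succ, Nat.cast_mul]; ring
      rw [e]
      exact sub_mem (ih (fun m hm => hA m (hm.trans n.le_succ)) k) (mul_mem (natCast_mem _ k) ihk)

/-- With `B n k = p^k A n k / p^n` the recursion gives `(k+1) B (n+1) (k+1) ≡ B n k` modulo `p`, and
each division by `k + 1 ≤ N < p` is allowed in `W`. The bound `N` is fixed while `n` varies, since
each step relates two levels. -/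
theorem coeff_congr_of_le {N : ℕ} (hN : N + 1 < p)
    (hrec : ∀ n k, ((k + 1 : ℕ) : ℂ_[p]) * A (n + 1) (k + 1) + k * A (n + 1) k = A n k)
    (hA : ∀ m ≤ N, A m 0 / p ^ m ∈ wittRing p) (k : ℕ) : ∀ n ≤ N, k ≤ n →
    ∃ c ∈ wittRing p, p ^ k * A n k / p ^ n =
      A (n - k) 0 / p ^ (n - k) / (k.factorial : ℂ_[p]) + p * c := by
  have hp0 := natCast_prime_ne_zero (p := p)
  have hfac : ∀ k ≤ N, (k.factorial : ℂ_[p])⁻¹ ∈ wittRing p := fun k hk =>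
    inv_natCast_mem_wittRing fun h => by
      have := (Nat.Prime.dvd_factorial Fact.out).1 h
      omega
  induction k with
  | zero => exact fun n _ _ => ⟨0, zero_mem _, by simp⟩
  | succ k ih =>
    rintro n hn hk
    obtain ⟨n, rfl⟩ := Nat.exists_eq_succ_of_ne_zero (by omega : n ≠ 0)
    rw [Nat.succ_eq_add_one] at *
    obtain ⟨c, hc, hc'⟩ := ih n (by omega) (by omega)
    -- This instance serves only to show that `B (n+1) k` is integral; in the recursion that number
    -- carries a factor `p`.
    obtain ⟨d, hd, hd'⟩ := ih (n + 1) hn (by omega)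
    have hB : p ^ k * A (n + 1) k / p ^ (n + 1) ∈ wittRing p := by
      rw [hd', div_eq_mul_inv _ (k.factorial : ℂ_[p])]
      exact add_mem (mul_mem (hA _ (by omega)) (hfac k (by omega))) (mul_mem (natCast_mem _ p) hd)
    have hk1 : ((k + 1 : ℕ) : ℂ_[p]) ≠ 0 := Nat.cast_ne_zero.2 k.succ_ne_zero
    have hkf : (k.factorial : ℂ_[p]) ≠ 0 := Nat.cast_ne_zero.2 k.factorial_ne_zero
    refine ⟨((k + 1 : ℕ) : ℂ_[p])⁻¹ * (c - k * (p ^ k * A (n + 1) k / p ^ (n + 1))),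
      mul_mem (inv_natCast_mem_wittRing fun h => ?_)
        (sub_mem hc (mul_mem (natCast_mem _ k) hB)), ?_⟩
    · have := Nat.le_of_dvd k.succ_pos h
      omega
    · rw [Nat.add_sub_add_right, Nat.factorial_succ, Nat.cast_mul]
      have h1 : ((k + 1 : ℕ) : ℂ_[p]) * (p ^ (k + 1) * A (n + 1) (k + 1) / p ^ (n + 1)) =
          p ^ k * A n k / p ^ n - p * (k * (p ^ k * A (n + 1) k / p ^ (n + 1))) := by
        rw [← hrec n k]
        field_simp
        ring
      rw [hc'] at h1
      generalize p ^ k * A (n + 1) k / (p : ℂ_[p]) ^ (n + 1) = B at *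
      rw [← mul_right_inj' hk1, h1]
      field_simp
      ring

/-- The factorization is `p^k A n k / p^n = p * (p^(k-n-1) / k!) * (k! A n k)`, where the valuation
of `k!` is at most `k - n - 1`. -/
theorem coeff_congr_of_lt (hn : n + 1 < p) (hA : ∀ k : ℕ, (k.factorial : ℂ_[p]) * A n k ∈ wittRing p)
    {k : ℕ} (hk : n < k) : ∃ c ∈ wittRing p, p ^ k * A n k / p ^ n = p * c := by
  have hp0 := natCast_prime_ne_zero (p := p)
  have h := padicValNat_factorial_add_lt hn hk
  refine ⟨_, mul_mem (pow_div_factorial_mem_wittRing (j := k - n - 1) (k := k) (by omega)) (hA k), ?_⟩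
  have hkf : (k.factorial : ℂ_[p]) ≠ 0 := Nat.cast_ne_zero.2 k.factorial_ne_zero
  obtain ⟨j, rfl⟩ : ∃ j, k = n + 1 + j := ⟨k - n - 1, by omega⟩
  rw [show n + 1 + j - n - 1 = j by omega, pow_add, pow_succ]
  field_simp

end TaylorExpansion

end ColemanPolylog
end

/-! ### The congruence. -/

theorem mainTheorem4 (p : ℕ) [Fact p.Prime] (n : ℕ) (hn : n + 1 < p) (α w : ℂ_[p])
    (hα : α ∈ ColemanPolylog.unitSet p) (hroot : ∃ m : ℕ, 0 < m ∧ α ^ m = 1)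
    (hw : w ∈ ColemanPolylog.wittRing p) :
    ColemanPolylog.CongrModP p
      (ColemanPolylog.polylog p n (α * (1 + (p : ℂ_[p]) * w)) / (p : ℂ_[p]) ^ n)
      (∑ k ∈ Finset.range (n + 1),
        ColemanPolylog.normalizedPolylog p (n - k) α * (w ^ k / (k.factorial : ℂ_[p]))) := by
  open ColemanPolylog in
  have hp0 := natCast_prime_ne_zero (p := p)
  obtain ⟨A, hAα, hA0, hrec, hsum⟩ := exists_taylor_coeff hα
  have hnorm : ∀ m ≤ n, A m 0 / p ^ m ∈ wittRing p := fun m hm => by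
    rw [hAα]
    -- The side condition holds because `p = 2` forces `n = 0`.
    exact normalizedPolylog_mem_wittRing (by omega) hα hroot
  have hAm : ∀ m ≤ n, A m 0 ∈ wittRing p := fun m hm => by
    rw [← div_mul_cancel₀ (A m 0) (pow_ne_zero m hp0)]
    exact mul_mem (hnorm m hm) (pow_mem (natCast_mem _ p) m)
  have hfact := factorial_mul_coeff_mem_wittRing hA0 hrec hAm
  have hfac : ∀ k ≤ n, (k.factorial : ℂ_[p])⁻¹ ∈ wittRing p := fun k hk =>
    inv_natCast_mem_wittRing fun h => by
      have := (Nat.Prime.dvd_factorial Fact.out).1 h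
      omega
  set S : ℕ → ℂ_[p] := fun k =>
    normalizedPolylog p (n - k) α * (w ^ k / (k.factorial : ℂ_[p])) with hS
  have hSmem : ∑ k ∈ Finset.range (n + 1), S k ∈ wittRing p := by
    refine sum_mem fun k hk => mul_mem ?_ ?_
    · exact normalizedPolylog_mem_wittRing (by omega) hα hroot
    · rw [div_eq_mul_inv]
      exact mul_mem (pow_mem hw k) (hfac k (Finset.mem_range_succ_iff.1 hk))
  -- The finite sum is extended by zero to an infinite series, so that the two sides are compared
  -- term by term.
  have hterm : ∀ k, ∃ c ∈ wittRing p, A n k * (p * w) ^ k / p ^ n -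
      (if k ∈ Finset.range (n + 1) then S k else 0) = p * c := by
    intro k
    split_ifs with hk
    · obtain ⟨c, hc, hc'⟩ := coeff_congr_of_le hn hrec hnorm k n le_rfl
        (Finset.mem_range_succ_iff.1 hk)
      refine ⟨c * w ^ k, mul_mem hc (pow_mem hw k), ?_⟩
      rw [hAα] at hc'
      simp only [hS, normalizedPolylog]
      rw [mul_pow]
      linear_combination w ^ k * hc'
    · obtain ⟨c, hc, hc'⟩ := coeff_congr_of_lt hn hfact
        (show n < k by simpa [Finset.mem_range_succ_iff] using hk)
      refine ⟨c * w ^ k, mul_mem hc (pow_mem hw k), ?_⟩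
      rw [mul_pow]
      linear_combination w ^ k * hc'
  choose c hc hc' using hterm
  have hpw : ‖(p : ℂ_[p]) * w‖ < 1 := by
    rw [norm_mul]
    exact (mul_le_of_le_one_right (norm_nonneg _) (norm_le_one_of_mem_wittRing hw)).trans_lt
      norm_natCast_prime_lt_one
  have hfin : HasSum (fun k => if k ∈ Finset.range (n + 1) then S k else 0)
      (∑ k ∈ Finset.range (n + 1), S k) := by
    rw [← Finset.sum_congr rfl fun k hk => if_pos hk]
    exact hasSum_sum_of_ne_finset_zero fun k hk => if_neg hk
  -- Dividing by `p` before passing to the limit makes every term an element of `W`. Closedness then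
  -- places the difference itself in `pW`.
  have htot := (((hsum n _ hpw).div_const ((p : ℂ_[p]) ^ n)).sub hfin).div_const (p : ℂ_[p])
  have hmem := hasSum_mem_wittRing (fun k => by
    rw [hc', mul_div_cancel_left₀ _ hp0]; exact hc k) htot
  refine ⟨?_, hSmem, _, hmem, (mul_div_cancel₀ _ hp0).symm⟩
  -- Integrality of the left side of the congruence follows from that of the finite sum and of the
  -- difference.
  rw [← sub_add_cancel (polylog p n (α * (1 + p * w)) / (p : ℂ_[p]) ^ n)
    (∑ k ∈ Finset.range (n + 1), S k), ← mul_div_cancel₀ (_ - _) hp0]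
  exact add_mem (mul_mem (natCast_mem _ p) hmem) hSmem
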